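/- Let $\Omega=\{-1,1\}^{\mathbb N}$, $\mathbb N=\{1,2,\dots\}$, with the left shift $\sigma$ and the metric $d_\Omega(x,y)=\sum_{n\ge1}2^{-n}|x_n-y_n|$. Put $S_n\varphi=\sum_{k=0}^{n-1}\varphi\circ\sigma^k$ and $d_n(x,y)=\max_{0\le k<n}d_\Omega(\sigma^kx,\sigma^ky)$. The Walters space $W(\Omega)$ is the set of continuous $\varphi$ such that for every $\epsilon>0$ there is $\eta>0$ with $|S_n\varphi(x)-S_n\varphi(y)|\le\epsilon$ whenever $n\ge1$ and $d_n(x,y)\le\eta$. For $0<s<1$ it carries the norm $\|\varphi\|_{W_s}=2\|\varphi\|_0+\sup_{n\ge1}\sup_{d_n(x,y)\le s}|S_n\varphi(x)-S_n\varphi(y)|$, where $\|\cdot\|_0$ is the supremum norm. The Ruelle operator of a potential $f$ is $L_f\varphi(x)=\frac12\sum_{a\in\{-1,1\}}e^{f(ax)}\varphi(ax)$. For $\varphi_1,\varphi_2$ and a measure $\mu$ let $C_{\varphi_1,\varphi_2,\mu}(n)=\int(\varphi_1\circ\sigma^n)\varphi_2\,d\mu-\int\varphi_1\,d\mu\int\varphi_2\,d\mu$.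 Let $\alpha>2$ and let $f(x)=\sum_{n\ge2}x_1x_n/n^{\alpha}$ be the (ferromagnetic) long-range Ising potential. Then: 1. $f\in W(\Omega)$, and $f$ is not $\gamma$-Hölder continuous (with respect to $d_\Omega$) for any $0<\gamma\le1$. 2. There are $\lambda_f>0$, a continuous $h_f>0$ and a Borel probability measure $\nu_f$ on $\Omega$ with $L_fh_f=\lambda_fh_f$, $L_f^*\nu_f=\lambda_f\nu_f$ and $\|\lambda_f^{-n}L_f^n\varphi-h_f\int\varphi\,d\nu_f\|_0\to0$ for all continuous $\varphi:\Omega\to\mathbb R$. For any such data put $\mu_f=h_f\nu_f$. 3. For $\varphi(x)=x_1$ there is $C>0$ with $C_{\varphi,\varphi,\mu_f}(n)\ge C/n^{\alpha}$ for all $n\ge1$. Hence $C_{\varphi,\varphi,\mu_f}(n)$ does not decay exponentially: there are no $A\in\mathbb R$ and $0<\tau<1$ with $|C_{\varphi,\varphi,\mu_f}(n)|\le A\tau^n$ for all $n\ge1$. 4. $L_f$ has no spectral gap on $W(\Omega)$. Precisely, for every $0<s<1$: (a) there are no $A\in\mathbb R$ and $0<\tau<1$ with $\|\lambda_f^{-n}L_f^n\varphi-h_f\int\varphi\,d\nu_f\|_0\le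 A\tau^n\|\varphi\|_{W_s}$ for all $n\ge1$ and all $\varphi\in W(\Omega)$; (b) let $L_f$ act on the complexification of $(W(\Omega),\|\cdot\|_{W_s})$, with domain $\{\varphi: L_f\varphi \text{ is again in the space}\}$; then it is not the case that its spectrum consists of an isolated simple eigenvalue $\lambda$ (one whose spectral projector $\frac1{2\pi i}\oint(z-L_f)^{-1}dz$ has one-dimensional range) and of a subset of a closed disc around $0$ of radius strictly smaller than $|\lambda|$. -/

import Mathlib

open MeasureTheory Filter Topology

noncomputable section

namespace WaltersIsing

/-- The alphabet `M = {-1, 1}`, with the metric (and Borel structure) inherited from `ℝ`. -/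
abbrev Spin : Type := {a : ℝ // a = -1 ∨ a = 1}

def spinUp : Spin := ⟨1, Or.inr rfl⟩

def spinDown : Spin := ⟨-1, Or.inl rfl⟩

/-- The space `Ω = {-1, 1}^ℕ` with product topology and product sigma-algebra.
The sequence `(x₁, x₂, x₃, …)` is `(x 0, x 1, x 2, …)`, that is, `xₙ` is `x (n - 1)`. -/
abbrev Conf : Type := ℕ → Spin

/-- The left shift `σ(x₁, x₂, …) = (x₂, x₃, …)`. -/
def shift (x : Conf) : Conf := fun n => x (n + 1)

/-- The sequence `ax = (a, x₁, x₂, …)`. -/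
def prepend (a : Spin) (x : Conf) : Conf
  | 0 => a
  | n + 1 => x n

/-- The metric `d_Ω(x, y) = ∑_{n ≥ 1} 2⁻ⁿ |xₙ - yₙ|`. -/
def confDist (x y : Conf) : ℝ := ∑' n : ℕ, (1 / 2 : ℝ) ^ (n + 1) * dist (x n) (y n)

/-- `d_n(x, y) = max_{0 ≤ k < n} d_Ω(σᵏ x, σᵏ y)`, for `n ≥ 1`. -/
def bowenDist (n : ℕ) (x y : Conf) : ℝ :=
  ⨆ k : Fin n, confDist (shift^[(k : ℕ)] x) (shift^[(k : ℕ)] y)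

/-- `φ` is continuous and satisfies the Walters condition.  For `E = ℝ` this is membership in
`W(Ω)`, for `E = ℂ` membership in its complexification.
(`birkhoffSum shift φ n x = φ x + φ (σ x) + ⋯ + φ (σⁿ⁻¹ x)`.) -/
def IsWalters {E : Type*} [NormedAddCommGroup E] (φ : Conf → E) : Prop :=
  Continuous φ ∧
    ∀ ε : ℝ, 0 < ε → ∃ η : ℝ, 0 < η ∧ ∀ n : ℕ, 1 ≤ n → ∀ x y : Conf,
      bowenDist n x y ≤ η → ‖birkhoffSum shift φ n x - birkhoffSum shift φ n y‖ ≤ ε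

/-- `‖φ‖_{W_s} = 2 ‖φ‖₀ + sup_{n ≥ 1} sup_{d_n(x,y) ≤ s} |S_n φ(x) - S_n φ(y)|`.  On Walters
functions it is a norm for `0 < s < 1`; the expansivity constant of the shift is `1` here. -/
def waltersNorm {E : Type*} [NormedAddCommGroup E] (s : ℝ) (φ : Conf → E) : ℝ :=
  2 * (⨆ x : Conf, ‖φ x‖) +
    sSup {t : ℝ | ∃ n : ℕ, 1 ≤ n ∧ ∃ x y : Conf, bowenDist n x y ≤ s ∧
      t = ‖birkhoffSum shift φ n x - birkhoffSum shift φ n y‖}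

/-- `γ`-Hölder continuity with respect to `d_Ω`. -/
def IsHolder (γ : ℝ) (φ : Conf → ℝ) : Prop :=
  ∃ K : ℝ, ∀ x y : Conf, |φ x - φ y| ≤ K * confDist x y ^ γ

/-- The a priori measure `(δ_{-1} + δ_1) / 2`. -/
def aprioriMeasure : Measure Spin :=
  (2⁻¹ : ENNReal) • (Measure.dirac spinDown + Measure.dirac spinUp)

/-- The Ruelle operator `L_f φ (x) = ∫_M exp(f(ax)) φ(ax) dμ(a)`. -/
def ruelle {E : Type*} [NormedAddCommGroup E] [NormedSpace ℝ E]
    (f : Conf → ℝ) (φ : Conf → E) : Conf → E :=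
  fun x => ∫ a, Real.exp (f (prepend a x)) • φ (prepend a x) ∂aprioriMeasure

/-- The Ruelle-Perron-Frobenius data `(λ_f, h_f, ν_f)` of a potential. -/
structure IsRuelleTriple (f : Conf → ℝ) (lam : ℝ) (h : Conf → ℝ) (ν : Measure Conf) :
    Prop where
  lam_pos : 0 < lam
  continuous : Continuous h
  pos : ∀ x, 0 < h x
  isProbabilityMeasure : IsProbabilityMeasure ν
  eigenfunction : ∀ x, ruelle f h x = lam * h x
  eigenmeasure : ∀ φ : Conf → ℝ, Continuous φ → ∫ x, ruelle f φ x ∂ν = lam * ∫ x, φ x ∂ν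
  tendsto : ∀ φ : Conf → ℝ, Continuous φ →
    TendstoUniformly (fun (n : ℕ) x => (lam ^ n)⁻¹ * (ruelle f)^[n] φ x)
      (fun x => h x * ∫ y, φ y ∂ν) atTop

/-- The measure `μ_f = h_f ν_f`. -/
def gibbsMeasure (h : Conf → ℝ) (ν : Measure Conf) : Measure Conf :=
  ν.withDensity fun x => ENNReal.ofReal (h x)

/-- The correlation function `C_{φ₁,φ₂,μ}(n)`. -/
def correlation (φ₁ φ₂ : Conf → ℝ) (μ : Measure Conf) (n : ℕ) : ℝ :=
  (∫ x, φ₁ (shift^[n] x) * φ₂ x ∂μ) - (∫ x, φ₁ x ∂μ) * ∫ x, φ₂ x ∂μ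

/-- `φ` is a complex Walters function with `(z - L_f) φ = ψ`.  If `ψ` is a Walters function, so
is `L_f φ`: thus `L_f` is used with the domain `{φ ∈ W(Ω) | L_f φ ∈ W(Ω)}`. -/
def IsResolventSolution (f : Conf → ℝ) (z : ℂ) (ψ φ : Conf → ℂ) : Prop :=
  IsWalters φ ∧ ∀ x, z * φ x - ruelle f φ x = ψ x

/-- The resolvent set of `L_f` on the complex Walters space with the norm `‖·‖_{W_s}`: the
operator `z - L_f` is a bijection from its domain onto the space, with bounded inverse. -/
def waltersResolventSet (f : Conf → ℝ) (s : ℝ) : Set ℂ :=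
  {z | (∀ ψ : Conf → ℂ, IsWalters ψ → ∃! φ : Conf → ℂ, IsResolventSolution f z ψ φ) ∧
    ∃ K : ℝ, ∀ ψ φ : Conf → ℂ, IsWalters ψ → IsResolventSolution f z ψ φ →
      waltersNorm s φ ≤ K * waltersNorm s ψ}

/-- The spectrum of `L_f` on the complex Walters space. -/
def waltersSpectrum (f : Conf → ℝ) (s : ℝ) : Set ℂ := (waltersResolventSet f s)ᶜ

/-- `lam` is an isolated simple eigenvalue of `L_f` on the complex Walters space: for some closed
disc `D` that meets the spectrum in `lam` only, the range of the spectral projector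
`(2πi)⁻¹ ∮_{∂D} (z - L_f)⁻¹ dz` is spanned by an eigenfunction `h`.  Point evaluations are
bounded functionals on the Walters space, so that the integral is evaluated pointwise. -/
def IsSimpleEigenvalue (f : Conf → ℝ) (s : ℝ) (lam : ℂ) : Prop :=
  ∃ h : Conf → ℂ, IsWalters h ∧ h ≠ 0 ∧ (∀ x, ruelle f h x = lam * h x) ∧
    ∃ δ : ℝ, 0 < δ ∧ Metric.closedBall lam δ ∩ waltersSpectrum f s = {lam} ∧
      ∀ (ψ : Conf → ℂ) (R : ℂ → Conf → ℂ), IsWalters ψ →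
        (∀ z ∈ Metric.sphere lam δ, IsResolventSolution f z ψ (R z)) →
        ∃ c : ℂ, ∀ x, (2 * (Real.pi : ℂ) * Complex.I)⁻¹ * (∮ z in C(lam, δ), R z x) = c * h x

/-- Presence of the spectral gap for `L_f` on the Walters space: there is a simple eigenvalue, and
the rest of the spectrum lies in a disc of radius strictly smaller than its modulus. -/
def HasSpectralGap (f : Conf → ℝ) (s : ℝ) : Prop :=
  ∃ lam : ℂ, IsSimpleEigenvalue f s lam ∧
    ∃ r : ℝ, r < ‖lam‖ ∧ ∀ z ∈ waltersSpectrum f s, z ≠ lam → ‖z‖ ≤ r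

/-- The long-range Ising potential `f(x) = ∑_{n ≥ 2} x₁ xₙ / n^α`. -/
def isingPotential (α : ℝ) (x : Conf) : ℝ :=
  ∑' k : ℕ, (x 0 : ℝ) * (x (k + 1) : ℝ) / ((k : ℝ) + 2) ^ α

/-- `φ(x) = x₁`. -/
def firstSpin (x : Conf) : ℝ := (x 0 : ℝ)

end WaltersIsing

end

open WaltersIsing

namespace WaltersIsing

/-! The coupling $n^{-\alpha}$ decays too slowly for any Hölder bound. Since $\alpha>2$, however,
the variation of $f$ over cylinders of length $M+1$ is $O((M+1)^{-\alpha/2})$, which is summable.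
Hence all Birkhoff sums have uniformly small distortion (`isingPotential_distortion`), and this is
the Walters condition. It also makes the ratios $L^n\varphi/L^n1$ contract in oscillation, with a
rate depending only on the modulus of continuity of $\varphi$ (`normalizedIterate_contraction`,
`normalizedIterate_uniformCauchy`). Their limit is $\nu$, and $\lambda^{-n}L^n1$ converges to $h$
(`exists_isRuelleTriple`).

The lower bounds come from ferromagnetism. The closed cone `Ferro` generated by nonnegative
constants and spins is stable under sums, products, exponentials and preimage averages, and its
members are nonnegative at the all-up configuration. For $b=x_1x_{k+2}=\pm1$ and
$J=(k+2)^{-\alpha}$, the identity $e^{Jb}(b-\tanh J)=b/\cosh J$ puts $L_f((b-\tanh J)\varphi)$ in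
the cone whenever $\varphi$ is (`ferro_ruelle_bond`). Taking $\varphi=h$ and integrating bounds the
correlation at distance $k+1$ below by $\tanh J$; spin flip symmetry removes the means. Taking
$\varphi=1$ and iterating bounds $\lambda^{-n}L^nx_1$ at the all-up configuration below by a power
law, although $\int x_1\,d\nu=0$; this rules out exponential convergence.

For the spectrum, a gap would force the simple eigenvalue to be $\lambda$, with an even
eigenfunction. The resolvent applied to the odd function $x_1$ is odd, so its spectral projection
vanishes. Its contour moments $\oint(\lambda-z)^{-m}R_z\,dz$, suitably normalized, are then bounded
functions $g_m$ with $g_0=x_1$ and $(\lambda-L)g_{m+1}=g_m$. Each step up this chain raises by one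
the exponent in the power law lower bound for $\lambda^{-j}L^jg_m$, which eventually contradicts
boundedness (`power_law_chain_absurd`). -/

instance : Finite Spin :=
  Set.Finite.to_subtype (Set.Finite.subset (Set.toFinite ({-1, 1} : Set ℝ)) fun a h => by
    rcases h with h | h <;> simp [h])

/-! ### Spins, the shift and cylinders. -/

theorem spin_eq (a : Spin) : a = spinDown ∨ a = spinUp := by
  rcases a with ⟨a, h | h⟩
  · left; exact Subtype.ext h
  · right; exact Subtype.ext h

@[simp] theorem coe_spinUp : (spinUp : ℝ) = 1 := rfl

@[simp] theorem coe_spinDown : (spinDown : ℝ) = -1 := rfl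

theorem abs_spin (a : Spin) : |(a : ℝ)| = 1 := by
  rcases spin_eq a with rfl | rfl <;> simp

theorem dist_spin_le (a b : Spin) : dist a b ≤ 2 := by
  rw [Subtype.dist_eq, Real.dist_eq]
  rcases spin_eq a with rfl | rfl <;> rcases spin_eq b with rfl | rfl <;> norm_num

theorem dist_spin_of_ne {a b : Spin} (h : a ≠ b) : dist a b = 2 := by
  rw [Subtype.dist_eq, Real.dist_eq]
  rcases spin_eq a with rfl | rfl <;> rcases spin_eq b with rfl | rfl <;> first
    | exact absurd rfl h
    | norm_num

@[simp] theorem prepend_zero (a : Spin) (x : Conf) : prepend a x 0 = a := rfl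

@[simp] theorem prepend_succ (a : Spin) (x : Conf) (n : ℕ) : prepend a x (n + 1) = x n := rfl

@[simp] theorem shift_prepend (a : Spin) (x : Conf) : shift (prepend a x) = x := rfl

theorem shift_iterate_apply (n : ℕ) (x : Conf) (i : ℕ) : shift^[n] x i = x (i + n) := by
  induction n generalizing x with
  | zero => rfl
  | succ n ih => rw [Function.iterate_succ_apply, ih]; simp [shift, add_assoc]

theorem continuous_shift : Continuous shift :=
  continuous_pi fun n => continuous_apply (n + 1)

theorem continuous_prepend (a : Spin) : Continuous (prepend a) :=
  continuous_pi fun n => by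
    cases n with
    | zero => exact continuous_const
    | succ n => exact continuous_apply n

/-- `x` and `y` have the same first `N` coordinates. -/
def Agree (N : ℕ) (x y : Conf) : Prop := ∀ i < N, x i = y i

theorem Agree.symm {N : ℕ} {x y : Conf} (h : Agree N x y) : Agree N y x :=
  fun i hi => (h i hi).symm

theorem Agree.mono {N M : ℕ} {x y : Conf} (h : Agree N x y) (hMN : M ≤ N) : Agree M x y :=
  fun i hi => h i (hi.trans_le hMN)

theorem Agree.zero (x y : Conf) : Agree 0 x y := fun i hi => absurd hi (Nat.not_lt_zero i)

theorem Agree.shift_iterate {n N : ℕ} {x y : Conf} (h : Agree (N + n) x y) :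
    Agree N (shift^[n] x) (shift^[n] y) := fun i hi => by
  simpa [shift_iterate_apply] using h (i + n) (by omega)

theorem Agree.prepend {N : ℕ} {x y : Conf} (h : Agree N x y) (a : Spin) :
    Agree (N + 1) (prepend a x) (prepend a y) := fun i hi => by
  cases i with
  | zero => rfl
  | succ i => exact h i (by omega)

theorem Agree.of_shift_iterate {n N : ℕ} {x y : Conf} (h : Agree n x y)
    (h' : Agree N (shift^[n] x) (shift^[n] y)) : Agree (n + N) x y := fun i hi => by
  rcases lt_or_ge i n with hin | hin
  · exact h i hin
  · have := h' (i - n) (by omega)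
    simpa [shift_iterate_apply, Nat.sub_add_cancel hin] using this

/-! ### Cylinders and the Bowen metrics. -/

section Metric

theorem confDist_summable (x y : Conf) :
    Summable fun n : ℕ => (1 / 2 : ℝ) ^ (n + 1) * dist (x n) (y n) := by
  refine Summable.of_nonneg_of_le (fun n => by positivity) (fun n => ?_)
    (summable_geometric_of_lt_one (by norm_num : (0 : ℝ) ≤ 1 / 2) (by norm_num))
  rw [pow_succ]
  nlinarith [dist_spin_le (x n) (y n), pow_pos (by norm_num : (0 : ℝ) < 1 / 2) n]

theorem confDist_le_of_agree {N : ℕ} {x y : Conf} (h : Agree N x y) :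
    confDist x y ≤ 2 * (1 / 2 : ℝ) ^ N := by
  have hs := confDist_summable x y
  unfold confDist
  rw [← hs.sum_add_tsum_nat_add N, Finset.sum_eq_zero, zero_add]
  · have hg : HasSum (fun i : ℕ => (1 / 2 : ℝ) ^ N * (1 / 2 : ℝ) ^ i) ((1 / 2 : ℝ) ^ N * 2) :=
      hasSum_geometric_two.mul_left _
    rw [mul_comm 2, ← hg.tsum_eq]
    refine ((summable_nat_add_iff N).2 hs).tsum_le_tsum (fun i => ?_) hg.summable
    rw [← pow_add, pow_succ, add_comm N i]
    nlinarith [dist_spin_le (x (i + N)) (y (i + N)),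
      pow_pos (by norm_num : (0 : ℝ) < 1 / 2) (i + N)]
  · intro i hi
    rw [h i (Finset.mem_range.1 hi), dist_self, mul_zero]

theorem le_confDist_of_ne {n : ℕ} {x y : Conf} (h : x n ≠ y n) :
    (1 / 2 : ℝ) ^ n ≤ confDist x y := by
  have := (confDist_summable x y).le_tsum n fun _ _ => by positivity
  rw [dist_spin_of_ne h, pow_succ] at this
  unfold confDist
  linarith

theorem confDist_le_two (x y : Conf) : confDist x y ≤ 2 := by
  simpa using confDist_le_of_agree (Agree.zero x y)

/-- A disagreement at index `i + k` is seen by the `k`-th shift at index `i` and costs at least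
$2^{-i}$. Letting `k` run up to `n - 1` and `i` up to `N` covers exactly the first `n + N`
coordinates. -/
theorem agree_of_bowenDist_le {n N : ℕ} (hn : 1 ≤ n) {x y : Conf} {η : ℝ}
    (hη : η < (1 / 2 : ℝ) ^ N) (h : bowenDist n x y ≤ η) : Agree (n + N) x y := by
  have key : ∀ k < n, ∀ i ≤ N, x (i + k) = y (i + k) := by
    intro k hk i hi
    by_contra hne
    have h1 : (1 / 2 : ℝ) ^ i ≤ confDist (shift^[k] x) (shift^[k] y) :=
      le_confDist_of_ne (by simpa [shift_iterate_apply] using hne)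
    have h2 : confDist (shift^[k] x) (shift^[k] y) ≤ bowenDist n x y :=
      le_ciSup (f := fun k : Fin n => confDist (shift^[(k : ℕ)] x) (shift^[(k : ℕ)] y))
        ⟨2, by rintro _ ⟨k, rfl⟩; exact confDist_le_two _ _⟩ ⟨k, hk⟩
    have h3 : (1 / 2 : ℝ) ^ N ≤ (1 / 2 : ℝ) ^ i :=
      pow_le_pow_of_le_one (by norm_num) (by norm_num) hi
    linarith
  intro i hi
  rcases lt_or_ge i n with hin | hin
  · simpa using key i hin 0 (Nat.zero_le _)
  · simpa [show i - (n - 1) + (n - 1) = i by omega] using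
      key (n - 1) (by omega) (i - (n - 1)) (by omega)

theorem bowenDist_le_of_agree {n N : ℕ} {x y : Conf} (h : Agree (n + N) x y) :
    bowenDist n x y ≤ 2 * (1 / 2 : ℝ) ^ N := by
  refine Real.iSup_le (fun k => ?_) (by positivity)
  have hk := k.2
  refine (confDist_le_of_agree
    (Agree.shift_iterate (N := N + (n - k)) (h.mono (by omega)))).trans ?_
  gcongr ?_ * ?_
  exact pow_le_pow_of_le_one (by norm_num) (by norm_num) (by omega)

end Metric

/-! ### Continuity and the Walters condition in terms of cylinders. -/

section Continuity

variable {E : Type*} [NormedAddCommGroup E]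

theorem setOf_agree_mem_nhds (N : ℕ) (x : Conf) : {y | Agree N x y} ∈ 𝓝 x := by
  have : {y | Agree N x y} = PiNat.cylinder x N := by
    ext y
    simp only [Set.mem_ofPred_eq, PiNat.mem_cylinder_iff, Agree, eq_comm]
  rw [this]
  exact (PiNat.isOpen_cylinder _ x N).mem_nhds (PiNat.self_mem_cylinder x N)

theorem exists_agree_subset {x : Conf} {U : Set Conf} (hU : U ∈ 𝓝 x) :
    ∃ N, ∀ y, Agree N x y → y ∈ U := by
  obtain ⟨_, ⟨z, N, rfl⟩, hx, hs⟩ :=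
    (PiNat.isTopologicalBasis_cylinders fun _ : ℕ => Spin).mem_nhds_iff.1 hU
  exact ⟨N, fun y hy => hs fun i hi => by rw [← hy i hi]; exact hx i hi⟩

theorem continuous_iff_agree {φ : Conf → E} :
    Continuous φ ↔ ∀ ε : ℝ, 0 < ε → ∃ N, ∀ x y, Agree N x y → ‖φ x - φ y‖ ≤ ε := by
  constructor
  · intro hφ ε hε
    have h1 : ∀ x, ∃ N, ∀ y, Agree N x y → ‖φ x - φ y‖ < ε / 2 := fun x => by
      refine exists_agree_subset (U := {y | ‖φ x - φ y‖ < ε / 2}) ?_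
      have : ContinuousAt (fun y => ‖φ x - φ y‖) x := by fun_prop
      exact this.eventually_lt continuousAt_const (by simpa using half_pos hε)
    choose N hN using h1
    obtain ⟨t, -, ht⟩ := (isCompact_univ (X := Conf)).elim_nhds_subcover
      (fun x => {y | Agree (N x) x y}) fun x _ => setOf_agree_mem_nhds _ _
    refine ⟨t.sup N, fun x y hxy => ?_⟩
    obtain ⟨z, hz, hzx⟩ : ∃ z ∈ t, Agree (N z) z x := by
      simpa using ht (Set.mem_univ x)
    have hzy : Agree (N z) z y := fun i hi =>
      (hzx i hi).trans (hxy i (hi.trans_le (Finset.le_sup hz)))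
    have := norm_sub_le_norm_sub_add_norm_sub (φ x) (φ z) (φ y)
    have h1 := hN z x hzx
    have h2 := hN z y hzy
    rw [norm_sub_rev] at h1
    linarith
  · intro h
    rw [continuous_iff_continuousAt]
    intro x
    rw [ContinuousAt, Metric.tendsto_nhds]
    intro ε hε
    obtain ⟨N, hN⟩ := h (ε / 2) (half_pos hε)
    filter_upwards [setOf_agree_mem_nhds N x] with y hy
    rw [dist_eq_norm]
    linarith [hN y x hy.symm]

theorem exists_norm_bound {φ : Conf → E} (hφ : Continuous φ) :
    ∃ B : ℝ, 0 < B ∧ ∀ x, ‖φ x‖ ≤ B := by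
  obtain ⟨B, hB⟩ := (isCompact_range hφ).isBounded.exists_norm_le
  exact ⟨max B 1, by positivity, fun x => (hB _ ⟨x, rfl⟩).trans (le_max_left _ _)⟩

/-- Bowen balls and cylinders of length `n + N` control each other uniformly in `n`, so the metric
can be dropped from here on. Continuity needs no separate clause: it is the case `n = 1`. -/
theorem isWalters_iff_agree {φ : Conf → E} :
    IsWalters φ ↔ ∀ ε : ℝ, 0 < ε → ∃ N, ∀ n x y, Agree (n + N) x y →
      ‖birkhoffSum shift φ n x - birkhoffSum shift φ n y‖ ≤ ε := by
  constructor
  · rintro ⟨-, h⟩ ε hε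
    obtain ⟨η, hη, h⟩ := h ε hε
    obtain ⟨N, hN⟩ := exists_pow_lt_of_lt_one (half_pos hη) (by norm_num : (1 / 2 : ℝ) < 1)
    refine ⟨N, fun n x y hxy => ?_⟩
    rcases Nat.eq_zero_or_pos n with rfl | hn
    · simpa using hε.le
    · exact h n hn x y ((bowenDist_le_of_agree hxy).trans (by linarith))
  · intro h
    constructor
    · refine continuous_iff_agree.2 fun ε hε => ?_
      obtain ⟨N, hN⟩ := h ε hε
      exact ⟨1 + N, fun x y hxy => by simpa using hN 1 x y hxy⟩
    · intro ε hε
      obtain ⟨N, hN⟩ := h ε hε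
      have hp : (0 : ℝ) < (1 / 2) ^ N := by positivity
      exact ⟨(1 / 2) ^ N / 2, half_pos hp, fun n hn x y hxy =>
        hN n x y (agree_of_bowenDist_le hn (half_lt_self hp) hxy)⟩

end Continuity

/-! ### The Ruelle operator as a weighted preimage average. -/

section Average

variable {E : Type*} [NormedAddCommGroup E] [NormedSpace ℝ E]

/-- The average of `φ` over the two preimages of `x` under the shift. -/
noncomputable def preimageAvg (φ : Conf → E) (x : Conf) : E :=
  (1 / 2 : ℝ) • (φ (prepend spinDown x) + φ (prepend spinUp x))

theorem ruelle_eq_preimageAvg [CompleteSpace E] (f : Conf → ℝ) (φ : Conf → E) :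
    ruelle f φ = preimageAvg fun x => Real.exp (f x) • φ x := by
  ext x
  unfold ruelle preimageAvg aprioriMeasure
  rw [integral_smul_measure, integral_add_measure, integral_dirac, integral_dirac]
  · simp
  · exact integrable_dirac (by simp)
  · exact integrable_dirac (by simp)

theorem ruelle_apply [CompleteSpace E] (f : Conf → ℝ) (φ : Conf → E) (x : Conf) :
    ruelle f φ x = (1 / 2 : ℝ) • (Real.exp (f (prepend spinDown x)) • φ (prepend spinDown x) +
      Real.exp (f (prepend spinUp x)) • φ (prepend spinUp x)) := by
  rw [ruelle_eq_preimageAvg]; rfl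

theorem continuous_ruelle [CompleteSpace E] {f : Conf → ℝ} (hf : Continuous f) {φ : Conf → E}
    (hφ : Continuous φ) : Continuous (ruelle f φ) := by
  have h1 := continuous_prepend spinDown
  have h2 := continuous_prepend spinUp
  rw [show ruelle f φ = _ from funext (ruelle_apply f φ)]
  fun_prop

theorem continuous_ruelle_iterate [CompleteSpace E] {f : Conf → ℝ} (hf : Continuous f)
    {φ : Conf → E} (hφ : Continuous φ) (n : ℕ) : Continuous ((ruelle f)^[n] φ) := by
  induction n with
  | zero => exact hφ
  | succ n ih => rw [Function.iterate_succ_apply']; exact continuous_ruelle hf ih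

/-- Collecting all the weights in one factor reduces comparisons of iterates at two points to
comparisons of Birkhoff sums along matching branches. -/
theorem ruelle_iterate_eq [CompleteSpace E] (f : Conf → ℝ) (n : ℕ) (φ : Conf → E) :
    (ruelle f)^[n] φ = preimageAvg^[n] fun x => Real.exp (birkhoffSum shift f n x) • φ x := by
  induction n generalizing φ with
  | zero => simp
  | succ n ih =>
    rw [Function.iterate_succ_apply, ih, Function.iterate_succ_apply, ruelle_eq_preimageAvg]
    congr 1
    ext x
    simp only [preimageAvg, birkhoffSum_succ', shift_prepend, Real.exp_add, smul_add, smul_smul]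
    congr 2 <;> ring

theorem ruelle_iterate_smul [CompleteSpace E] (f : Conf → ℝ) (n : ℕ) (c : ℝ) (φ : Conf → E) :
    (ruelle f)^[n] (fun x => c • φ x) = fun x => c • (ruelle f)^[n] φ x := by
  induction n with
  | zero => rfl
  | succ n ih =>
    rw [Function.iterate_succ_apply', Function.iterate_succ_apply', ih]
    ext x
    simp only [ruelle_apply, smul_add, smul_smul]
    congr 2 <;> ring

theorem ruelle_iterate_add [CompleteSpace E] (f : Conf → ℝ) (n : ℕ) (φ ψ : Conf → E) :
    (ruelle f)^[n] (fun x => φ x + ψ x) =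
      fun x => (ruelle f)^[n] φ x + (ruelle f)^[n] ψ x := by
  induction n with
  | zero => rfl
  | succ n ih =>
    simp only [Function.iterate_succ_apply', ih]
    ext x
    simp only [ruelle_apply, smul_add]
    abel

theorem ruelle_iterate_sub [CompleteSpace E] (f : Conf → ℝ) (n : ℕ) (φ ψ : Conf → E) :
    (ruelle f)^[n] (fun x => φ x - ψ x) =
      fun x => (ruelle f)^[n] φ x - (ruelle f)^[n] ψ x := by
  have h := ruelle_iterate_add f n φ (fun x => (-1 : ℝ) • ψ x)
  rw [ruelle_iterate_smul] at h
  simpa [sub_eq_add_neg] using h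

/-- Functions of the past factor out of the Ruelle operator. -/
theorem ruelle_iterate_mul_comp_shift (f : Conf → ℝ) (n : ℕ) (φ ψ : Conf → ℝ) (x : Conf) :
    (ruelle f)^[n] (fun x => φ (shift^[n] x) * ψ x) x = φ x * (ruelle f)^[n] ψ x := by
  induction n generalizing ψ x with
  | zero => rfl
  | succ n ih =>
    have h : ruelle f (fun x => φ (shift^[n + 1] x) * ψ x) =
        fun x => φ (shift^[n] x) * ruelle f ψ x := by
      ext x
      simp only [ruelle_apply, Function.iterate_succ_apply, shift_prepend, smul_eq_mul]
      ring
    rw [Function.iterate_succ_apply, h, Function.iterate_succ_apply, ih]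

/-- Comparison of iterated preimage averages at two points along corresponding branches. -/
theorem preimageAvg_iterate_le (n : ℕ) {G H : Conf → ℝ} {x y : Conf}
    (h : ∀ u v, Agree n u v → shift^[n] u = x → shift^[n] v = y → G u ≤ H v) :
    preimageAvg^[n] G x ≤ preimageAvg^[n] H y := by
  induction n generalizing G H with
  | zero => exact h x y (Agree.zero _ _) rfl rfl
  | succ n ih =>
    rw [Function.iterate_succ_apply, Function.iterate_succ_apply]
    refine ih fun u v huv hu hv => ?_
    have key : ∀ a, G (prepend a u) ≤ H (prepend a v) := fun a =>
      h _ _ (huv.prepend a) (by simpa using hu) (by simpa using hv)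
    simp only [preimageAvg, smul_eq_mul]
    linarith [key spinDown, key spinUp]

theorem ruelle_iterate_le (f : Conf → ℝ) (n : ℕ) {φ ψ : Conf → ℝ} {x y : Conf}
    (h : ∀ u v, Agree n u v → shift^[n] u = x → shift^[n] v = y →
      Real.exp (birkhoffSum shift f n u) * φ u ≤ Real.exp (birkhoffSum shift f n v) * ψ v) :
    (ruelle f)^[n] φ x ≤ (ruelle f)^[n] ψ y := by
  rw [ruelle_iterate_eq, ruelle_iterate_eq]
  exact preimageAvg_iterate_le n h

theorem ruelle_iterate_mono (f : Conf → ℝ) (n : ℕ) {φ ψ : Conf → ℝ} (h : ∀ x, φ x ≤ ψ x)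
    (x : Conf) : (ruelle f)^[n] φ x ≤ (ruelle f)^[n] ψ x := by
  refine ruelle_iterate_le f n fun u v huv hu hv => ?_
  obtain rfl : u = v := by
    ext1 i
    rcases lt_or_ge i n with hi | hi
    · exact huv i hi
    · have := congrFun (hu.trans hv.symm) (i - n)
      simpa [shift_iterate_apply, Nat.sub_add_cancel hi] using this
  exact mul_le_mul_of_nonneg_left (h u) (Real.exp_pos _).le

theorem ruelle_iterate_pos (f : Conf → ℝ) (n : ℕ) {φ : Conf → ℝ} (h : ∀ x, 0 < φ x)
    (x : Conf) : 0 < (ruelle f)^[n] φ x := by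
  induction n generalizing φ x with
  | zero => exact h x
  | succ n ih =>
    rw [Function.iterate_succ_apply]
    refine ih (fun x => ?_) x
    rw [ruelle_apply]
    have h1 := h (prepend spinDown x)
    have h2 := h (prepend spinUp x)
    simp only [smul_eq_mul]
    positivity

end Average

/-! ### Regularity of the Ising potential. -/

/-- A power law does not decay exponentially. -/
theorem not_forall_rpow_le_geometric {c α A τ : ℝ} (hc : 0 < c) (hτ : 0 < τ) (hτ1 : τ < 1) :
    ¬ ∀ n : ℕ, 1 ≤ n → c / (n : ℝ) ^ α ≤ A * τ ^ n := by
  intro h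
  have h1 := (tendsto_rpow_mul_exp_neg_mul_atTop_nhds_zero α (-Real.log τ)
    (by linarith [Real.log_neg hτ hτ1])).comp tendsto_natCast_atTop_atTop
  have h2 : Tendsto (fun n : ℕ => A * ((n : ℝ) ^ α * τ ^ n)) atTop (𝓝 (A * 0)) := by
    refine Tendsto.const_mul A (h1.congr fun n => ?_)
    simp only [Function.comp_apply, neg_neg]
    rw [mul_comm (Real.log τ), Real.exp_nat_mul, Real.exp_log hτ]
  rw [mul_zero] at h2
  obtain ⟨n, hn, hn1⟩ := ((h2.eventually_lt_const hc).and (eventually_ge_atTop 1)).exists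
  have hpos : (0 : ℝ) < (n : ℝ) ^ α := Real.rpow_pos_of_pos (by exact_mod_cast hn1) _
  have := (div_le_iff₀ hpos).1 (h n hn1)
  rw [mul_assoc, mul_comm (τ ^ n)] at this
  linarith

section Ising

variable {α : ℝ}

theorem summable_add_rpow_neg {β : ℝ} (hβ : 1 < β) (k : ℕ) :
    Summable fun n : ℕ => ((n : ℝ) + k) ^ (-β) := by
  have := (summable_nat_add_iff k).2 (Real.summable_nat_rpow.2 (by linarith : -β < -1))
  simpa using this

theorem isingPotential_hasSum (hα : 1 < α) (x : Conf) :
    HasSum (fun k : ℕ => (x 0 : ℝ) * (x (k + 1) : ℝ) / ((k : ℝ) + 2) ^ α) (isingPotential α x) := by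
  refine Summable.hasSum (Summable.of_norm_bounded (summable_add_rpow_neg hα 2) fun k => ?_)
  rw [Real.norm_eq_abs, abs_div, abs_mul, abs_spin, abs_spin,
    abs_of_nonneg (by positivity : (0 : ℝ) ≤ ((k : ℝ) + 2) ^ α), Real.rpow_neg (by positivity)]
  simp

/-- Variation of the Ising potential over cylinders. -/
theorem abs_isingPotential_sub_le (hα : 2 < α) : ∃ B : ℝ, 0 ≤ B ∧ ∀ (M : ℕ) (x y : Conf),
    Agree (M + 1) x y →
      |isingPotential α x - isingPotential α y| ≤ B * ((M : ℝ) + 1) ^ (-(α / 2)) := by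
  have hs := summable_add_rpow_neg (by linarith : 1 < α / 2) 1
  refine ⟨2 * ∑' i : ℕ, ((i : ℝ) + (1 : ℕ)) ^ (-(α / 2)), by positivity, fun M x y hxy => ?_⟩
  have hd := (isingPotential_hasSum (by linarith : 1 < α) x).sub
    (isingPotential_hasSum (by linarith : 1 < α) y)
  rw [← hasSum_nat_add_iff' M, Finset.sum_eq_zero, sub_zero] at hd
  · rw [← Real.norm_eq_abs, mul_right_comm]
    have hg : HasSum (fun i : ℕ => 2 * ((M : ℝ) + 1) ^ (-(α / 2)) *
        ((i : ℝ) + (1 : ℕ)) ^ (-(α / 2))) _ := hs.hasSum.mul_left _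
    refine hd.norm_le_of_bounded hg fun i => ?_
    have hp : (0 : ℝ) < (((i + M : ℕ) : ℝ) + 2) ^ α := by positivity
    have h1 : |(x 0 : ℝ) * (x (i + M + 1) : ℝ) - (y 0 : ℝ) * (y (i + M + 1) : ℝ)| ≤ 2 := by
      refine (abs_sub _ _).trans ?_
      simp only [abs_mul, abs_spin]
      norm_num
    rw [← sub_div, Real.norm_eq_abs, abs_div, abs_of_pos hp, mul_assoc, div_eq_mul_inv,
      ← Real.rpow_neg (by positivity)]
    refine mul_le_mul h1 ?_ (by positivity) (by norm_num)
    -- The decay is shared equally between `M` and `i`. As $\alpha/2>1$, the factor in `i` is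
    -- summable here, and the factor in `M` is summable later over the terms of a Birkhoff sum.
    have h2 : ((M : ℝ) + 1) * ((i : ℝ) + (1 : ℕ)) ≤ ((((i + M : ℕ) : ℝ) + 2)) ^ (2 : ℝ) := by
      push_cast
      rw [Real.rpow_two]
      nlinarith [(Nat.cast_nonneg i : (0 : ℝ) ≤ i), (Nat.cast_nonneg M : (0 : ℝ) ≤ M),
        mul_nonneg (Nat.cast_nonneg i : (0 : ℝ) ≤ i) (Nat.cast_nonneg M : (0 : ℝ) ≤ M)]
    rw [← Real.mul_rpow (by positivity) (by positivity),
      show -α = 2 * (-(α / 2)) by ring, Real.rpow_mul (by positivity)]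
    exact Real.rpow_le_rpow_of_nonpos (by positivity) h2 (by linarith)
  · intro i hi
    have := Finset.mem_range.1 hi
    rw [hxy 0 (by omega), hxy (i + 1) (by omega), sub_self]

/-- The distortion of the Birkhoff sums along branches that agree `N` steps further. -/
theorem isingPotential_distortion (hα : 2 < α) : ∃ ε : ℕ → ℝ, Tendsto ε atTop (𝓝 0) ∧
    ∀ (n N : ℕ) (x y : Conf), Agree (n + N) x y →
      |birkhoffSum shift (isingPotential α) n x - birkhoffSum shift (isingPotential α) n y| ≤
        ε N := by
  obtain ⟨B, hB, h⟩ := abs_isingPotential_sub_le hα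
  have hs := (summable_add_rpow_neg (by linarith : 1 < α / 2) 1).mul_left B
  refine ⟨fun N => ∑' j : ℕ, B * (((j + N : ℕ) : ℝ) + (1 : ℕ)) ^ (-(α / 2)),
    tendsto_sum_nat_add fun j : ℕ => B * ((j : ℝ) + (1 : ℕ)) ^ (-(α / 2)), fun n N x y hxy => ?_⟩
  simp only [birkhoffSum]
  rw [← Finset.sum_sub_distrib]
  refine (Finset.abs_sum_le_sum_abs _ _).trans ?_
  -- Counted from the end, the term with index `j` compares points that agree on `j + N + 1`
  -- coordinates, so the whole sum is bounded by a tail of one convergent series, uniformly in `n`.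
  rw [← Finset.sum_range_reflect]
  refine (Finset.sum_le_sum fun j hj => ?_).trans
    (((summable_nat_add_iff N).2 hs).sum_le_tsum (Finset.range n) fun _ _ => by positivity)
  have hj := Finset.mem_range.1 hj
  refine (h (j + N) _ _ (Agree.shift_iterate (hxy.mono (by omega)))).trans_eq ?_
  simp

theorem isWalters_isingPotential (hα : 2 < α) : IsWalters (isingPotential α) := by
  obtain ⟨ε, hε, h⟩ := isingPotential_distortion hα
  refine isWalters_iff_agree.2 fun e he => ?_
  obtain ⟨N, hN⟩ := (hε.eventually_lt_const he).exists
  exact ⟨N, fun n x y hxy => (h n N x y hxy).trans hN.le⟩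

/-- The configuration with all spins up. -/
def allUp : Conf := fun _ => spinUp

/-- Flipping one distant spin of the all-up configuration changes the potential by a power of the
distance to the origin, while the metric changes exponentially little. -/
theorem not_isHolder_isingPotential (hα : 2 < α) {γ : ℝ} (hγ : 0 < γ) :
    ¬ IsHolder γ (isingPotential α) := by
  rintro ⟨K, hK⟩
  refine not_forall_rpow_le_geometric (c := 2 / 3 ^ α) (α := α) (A := |K|) (by positivity)
    (Real.rpow_pos_of_pos one_half_pos γ) (Real.rpow_lt_one (by norm_num) one_half_lt_one hγ)
    fun n hn => ?_
  set y : Conf := Function.update allUp (n + 1) spinDown with hy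
  have hagree : Agree (n + 1) allUp y := fun i hi => by
    rw [hy, Function.update_of_ne hi.ne]
  have h1 : 2 / ((n : ℝ) + 2) ^ α = isingPotential α allUp - isingPotential α y := by
    have hd := (isingPotential_hasSum (by linarith : 1 < α) allUp).sub
      (isingPotential_hasSum (by linarith : 1 < α) y)
    have hsingle := hasSum_single n (f := fun k : ℕ =>
      (allUp 0 : ℝ) * (allUp (k + 1) : ℝ) / ((k : ℝ) + 2) ^ α -
      (y 0 : ℝ) * (y (k + 1) : ℝ) / ((k : ℝ) + 2) ^ α) (fun k hk => by
        have : y (k + 1) = allUp (k + 1) := by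
          rw [hy, Function.update_of_ne (by omega)]
        rw [this, ← hagree 0 (by omega), sub_self])
    rw [hd.unique hsingle, ← hagree 0 (by omega), hy, Function.update_self]
    simp only [allUp, coe_spinUp, coe_spinDown]
    ring
  have h2 : confDist allUp y ≤ (1 / 2) ^ n := by
    refine (confDist_le_of_agree hagree).trans_eq ?_
    rw [pow_succ]; ring
  have hn1 : (1 : ℝ) ≤ n := by exact_mod_cast hn
  have h0 : 0 ≤ confDist allUp y := tsum_nonneg fun _ => by positivity
  calc 2 / 3 ^ α / (n : ℝ) ^ α = 2 / (3 * (n : ℝ)) ^ α := by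
        rw [Real.mul_rpow (by norm_num) (by positivity), div_div]
    _ ≤ 2 / ((n : ℝ) + 2) ^ α := by
        gcongr
        linarith
    _ ≤ |isingPotential α allUp - isingPotential α y| := h1.trans_le (le_abs_self _)
    _ ≤ K * confDist allUp y ^ γ := hK _ _
    _ ≤ |K| * confDist allUp y ^ γ := by gcongr; exact le_abs_self K
    _ ≤ |K| * ((1 / 2) ^ n) ^ γ := by gcongr
    _ = |K| * ((1 / 2) ^ γ) ^ n := by
        rw [← Real.rpow_natCast, ← Real.rpow_natCast, ← Real.rpow_mul (by norm_num),
          ← Real.rpow_mul (by norm_num), mul_comm γ]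

end Ising

/-! ### Normalized iterates and their contraction. -/

/-- `ε` bounds the variation of all Birkhoff sums `S_n f` on cylinders of length `n + N`. -/
structure HasDistortion (f : Conf → ℝ) (ε : ℕ → ℝ) : Prop where
  tendsto : Tendsto ε atTop (𝓝 0)
  le : ∀ (n N : ℕ) (x y : Conf), Agree (n + N) x y →
    |birkhoffSum shift f n x - birkhoffSum shift f n y| ≤ ε N

/-- The partition function `L_f^n 1`. -/
noncomputable def partitionFun (f : Conf → ℝ) (n : ℕ) : Conf → ℝ := (ruelle f)^[n] fun _ => 1

/-- The normalized iterate `L_f^n φ / L_f^n 1`. -/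
noncomputable def normalizedIterate (f : Conf → ℝ) (n : ℕ) (φ : Conf → ℝ) (x : Conf) : ℝ :=
  (ruelle f)^[n] φ x / partitionFun f n x

theorem partitionFun_pos (f : Conf → ℝ) (n : ℕ) (x : Conf) : 0 < partitionFun f n x :=
  ruelle_iterate_pos f n (fun _ => one_pos) x

theorem partitionFun_add (f : Conf → ℝ) (m n : ℕ) :
    partitionFun f (m + n) = (ruelle f)^[m] (partitionFun f n) :=
  Function.iterate_add_apply _ _ _ _

theorem ruelle_iterate_eq_mul (f : Conf → ℝ) (n : ℕ) (φ : Conf → ℝ) (x : Conf) :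
    (ruelle f)^[n] φ x = partitionFun f n x * normalizedIterate f n φ x :=
  (mul_div_cancel₀ _ (partitionFun_pos f n x).ne').symm

theorem ruelle_iterate_const_mul (f : Conf → ℝ) (n : ℕ) (c : ℝ) (φ : Conf → ℝ) (x : Conf) :
    (ruelle f)^[n] (fun x => c * φ x) x = c * (ruelle f)^[n] φ x :=
  congrFun (ruelle_iterate_smul f n c φ) x

/-- A later normalized iterate is a weighted average of an earlier one, with weights coming from
$L^n1$, so the range can only shrink. -/
theorem normalizedIterate_mem_Icc (f : Conf → ℝ) {n : ℕ} {φ : Conf → ℝ} {a b : ℝ}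
    (h : ∀ x, normalizedIterate f n φ x ∈ Set.Icc a b) (k : ℕ) (x : Conf) :
    normalizedIterate f (n + k) φ x ∈ Set.Icc a b := by
  have hp := partitionFun_pos f (k + n) x
  have hn := partitionFun_pos f n
  rw [add_comm n k, normalizedIterate, Set.mem_Icc, le_div_iff₀ hp, div_le_iff₀ hp,
    partitionFun_add, Function.iterate_add_apply, ← ruelle_iterate_const_mul,
    ← ruelle_iterate_const_mul]
  constructor
  · refine ruelle_iterate_mono f k (fun x => ?_) x
    rw [ruelle_iterate_eq_mul f n, mul_comm]
    exact mul_le_mul_of_nonneg_left (h x).1 (hn x).le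
  · refine ruelle_iterate_mono f k (fun x => ?_) x
    rw [ruelle_iterate_eq_mul f n, mul_comm]
    exact mul_le_mul_of_nonneg_right (h x).2 (hn x).le

theorem abs_normalizedIterate_le (f : Conf → ℝ) {φ : Conf → ℝ} {B : ℝ} (h : ∀ x, |φ x| ≤ B)
    (n : ℕ) (x : Conf) : |normalizedIterate f n φ x| ≤ B := by
  have := normalizedIterate_mem_Icc f (n := 0) (φ := φ) (a := -B) (b := B)
    (fun x => by simpa [normalizedIterate, partitionFun] using abs_le.1 (h x)) n x
  rw [zero_add] at this
  exact abs_le.2 this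

theorem exists_le_add_of_sub_le {ρ : Conf → ℝ} {W : ℝ} (h : ∀ x y, ρ x - ρ y ≤ W) :
    ∃ a, ∀ x, ρ x ∈ Set.Icc a (a + W) := by
  have : Nonempty Conf := ⟨allUp⟩
  have hb : BddBelow (Set.range ρ) :=
    ⟨ρ allUp - W, by rintro _ ⟨y, rfl⟩; linarith [h allUp y]⟩
  refine ⟨⨅ x, ρ x, fun x => ⟨ciInf_le hb x, ?_⟩⟩
  have : ρ x - W ≤ ⨅ x, ρ x := le_ciInf fun y => by linarith [h x y]
  linarith

theorem exists_modulus {φ : Conf → ℝ} (hφ : Continuous φ) :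
    ∃ v : ℕ → ℝ, Tendsto v atTop (𝓝 0) ∧ ∀ N x y, Agree N x y → |φ x - φ y| ≤ v N := by
  obtain ⟨B, -, hB⟩ := exists_norm_bound hφ
  have hbdd : ∀ N, BddAbove (Set.range fun p : {p : Conf × Conf // Agree N p.1 p.2} =>
      |φ p.1.1 - φ p.1.2|) := fun N => ⟨B + B, by
    rintro _ ⟨p, rfl⟩
    exact (norm_sub_le _ _).trans (add_le_add (hB _) (hB _))⟩
  refine ⟨fun N => ⨆ p : {p : Conf × Conf // Agree N p.1 p.2}, |φ p.1.1 - φ p.1.2|, ?_,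
    fun N x y hxy => le_ciSup (hbdd N) ⟨(x, y), hxy⟩⟩
  rw [Metric.tendsto_atTop]
  intro e he
  obtain ⟨N, hN⟩ := continuous_iff_agree.1 hφ (e / 2) (half_pos he)
  refine ⟨N, fun n hn => ?_⟩
  rw [Real.dist_0_eq_abs, abs_of_nonneg (Real.iSup_nonneg fun _ => abs_nonneg _)]
  refine lt_of_le_of_lt (Real.iSup_le (fun p => ?_) (half_pos he).le) (half_lt_self he)
  exact hN _ _ (p.2.mono hn)

namespace HasDistortion

variable {f : Conf → ℝ} {ε : ℕ → ℝ} (hf : HasDistortion f ε)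
include hf

theorem nonneg (N : ℕ) : 0 ≤ ε N := by
  simpa using hf.le 0 N allUp allUp fun _ _ => rfl

theorem exp_le {n N : ℕ} {x y u v : Conf} (hxy : Agree N x y) (huv : Agree n u v)
    (hu : shift^[n] u = x) (hv : shift^[n] v = y) :
    Real.exp (birkhoffSum shift f n u) ≤
      Real.exp (ε N) * Real.exp (birkhoffSum shift f n v) := by
  rw [← Real.exp_add]
  refine Real.exp_le_exp.2 ?_
  have := (abs_le.1 (hf.le n N u v (huv.of_shift_iterate (by rwa [hu, hv])))).2
  linarith

theorem partitionFun_le (n : ℕ) {N : ℕ} {x y : Conf} (hxy : Agree N x y) :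
    partitionFun f n x ≤ Real.exp (ε N) * partitionFun f n y := by
  rw [partitionFun, ← ruelle_iterate_const_mul]
  refine ruelle_iterate_le f n fun u v huv hu hv => ?_
  rw [mul_one, mul_one, mul_comm]
  exact hf.exp_le hxy huv hu hv

theorem ruelle_iterate_le_add {φ : Conf → ℝ} {B : ℝ} (hB : ∀ x, |φ x| ≤ B) {v : ℝ} {N : ℕ}
    (hv : ∀ x y, Agree N x y → |φ x - φ y| ≤ v) (n : ℕ) {x y : Conf} (hxy : Agree N x y) :
    (ruelle f)^[n] φ x ≤
      (ruelle f)^[n] φ y + (v + (Real.exp (ε N) - 1) * B) * partitionFun f n y := by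
  set κ := v + (Real.exp (ε N) - 1) * B
  have h : (ruelle f)^[n] φ x ≤ (ruelle f)^[n] (fun x => φ x + κ * 1) y := by
    refine ruelle_iterate_le f n fun u w huw hu hw => ?_
    have h1 := hf.exp_le hxy huw hu hw
    have h2 := hf.exp_le hxy.symm huw.symm hw hu
    have h3 := (abs_le.1 (hv u w ((huw.of_shift_iterate (by rwa [hu, hw])).mono (by omega)))).2
    set s := Real.exp (birkhoffSum shift f n u)
    set t := Real.exp (birkhoffSum shift f n w)
    have hs : 0 < s := Real.exp_pos _
    have ht : 0 < t := Real.exp_pos _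
    have hE : 1 ≤ Real.exp (ε N) := Real.one_le_exp (hf.nonneg N)
    have h4 : |s - t| ≤ t * (Real.exp (ε N) - 1) := by
      rw [abs_le]
      constructor
      · rcases le_total t s with hts | hts
        · nlinarith
        · nlinarith
      · linarith
    have h5 : (s - t) * φ u ≤ t * (Real.exp (ε N) - 1) * B :=
      (le_abs_self _).trans ((abs_mul _ _).trans_le
        (mul_le_mul h4 (hB u) (abs_nonneg _) ((abs_nonneg _).trans h4)))
    have h6 : t * (φ u - φ w) ≤ t * v := mul_le_mul_of_nonneg_left h3 ht.le
    have : t * (φ w + κ * 1) = t * φ w + t * v + t * (Real.exp (ε N) - 1) * B := by ring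
    linarith
  rw [ruelle_iterate_add] at h
  simp only [ruelle_iterate_const_mul] at h
  exact h

/-- Equicontinuity of the normalized iterates: the bound does not involve `n`, and uses only a bound
and a modulus of `φ`. -/
theorem normalizedIterate_sub_le {φ : Conf → ℝ} {B : ℝ} (hB : ∀ x, |φ x| ≤ B) {v : ℝ} {N : ℕ}
    (hv : ∀ x y, Agree N x y → |φ x - φ y| ≤ v) (n : ℕ) {x y : Conf} (hxy : Agree N x y) :
    |normalizedIterate f n φ x - normalizedIterate f n φ y| ≤
      Real.exp (ε 0) * (v + (Real.exp (ε N) - 1) * B) + (Real.exp (ε N) - 1) * B := by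
  have main : ∀ x y, Agree N x y → normalizedIterate f n φ x - normalizedIterate f n φ y ≤
      Real.exp (ε 0) * (v + (Real.exp (ε N) - 1) * B) + (Real.exp (ε N) - 1) * B := by
    intro x y hxy
    have h1 := hf.ruelle_iterate_le_add hB hv n hxy
    have h2 := hf.partitionFun_le n hxy.symm
    have h2' := hf.partitionFun_le n hxy
    have h3 := hf.partitionFun_le n (Agree.zero y x)
    have hx := partitionFun_pos f n x
    have hR := abs_le.1 (abs_normalizedIterate_le f hB n y)
    have hB0 : 0 ≤ B := (abs_nonneg _).trans (hB x)
    have hv0 : 0 ≤ v := (abs_nonneg _).trans (hv x x fun _ _ => rfl)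
    have hE : 1 ≤ Real.exp (ε N) := Real.one_le_exp (hf.nonneg N)
    rw [ruelle_iterate_eq_mul f n φ x, ruelle_iterate_eq_mul f n φ y] at h1
    set r := normalizedIterate f n φ x
    set q := normalizedIterate f n φ y
    set X := partitionFun f n x
    set Y := partitionFun f n y
    set δ := Real.exp (ε N) - 1
    have hδ : 0 ≤ δ := sub_nonneg.2 hE
    have hY := partitionFun_pos f n y
    have h4 : |Y - X| ≤ δ * X := by
      rw [abs_le]
      constructor
      · rcases le_total X Y with hXY | hXY
        · nlinarith
        · have : X - Y ≤ δ * Y := by linarith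
          nlinarith
      · linarith
    have h5 : (Y - X) * q ≤ δ * X * B :=
      (le_abs_self _).trans ((abs_mul _ _).trans_le
        (mul_le_mul h4 (abs_le.2 hR) (abs_nonneg _) (by positivity)))
    have h6 : (v + δ * B) * Y ≤ (v + δ * B) * (Real.exp (ε 0) * X) :=
      mul_le_mul_of_nonneg_left h3 (by positivity)
    refine le_of_mul_le_mul_left ?_ hx
    linarith
  rw [abs_le]
  exact ⟨by linarith [main y x hxy.symm], main x y hxy⟩

/-- Matching branches over two arbitrary points share their first `m` coordinates, where `ψ` varies
by at most `κ`. One distortion factor pays for the Birkhoff sum, the other for the partition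
function. -/
theorem ruelle_iterate_minorization {n m : ℕ} {ψ : Conf → ℝ} (hψ : ∀ x, 0 ≤ ψ x) {κ : ℝ}
    (hκ : ∀ u v, Agree m u v → |ψ u - ψ v| ≤ κ) (x y : Conf) :
    (ruelle f)^[m] (fun u => partitionFun f n u * ψ u) y - κ * partitionFun f (m + n) y ≤
      Real.exp (ε 0) ^ 2 * (ruelle f)^[m] (fun u => partitionFun f n u * ψ u) x := by
  rw [← ruelle_iterate_const_mul, partitionFun_add, ← ruelle_iterate_const_mul,
    ← congrFun (ruelle_iterate_sub f m _ _) y]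
  refine ruelle_iterate_le f m fun u v huv hu hv => ?_
  have h1 := hf.exp_le (Agree.zero y x) huv hu hv
  have h2 := hf.partitionFun_le n (Agree.zero u v)
  have h3 := (abs_le.1 (hκ u v huv)).2
  calc Real.exp (birkhoffSum shift f m u) *
        (partitionFun f n u * ψ u - κ * partitionFun f n u)
      = Real.exp (birkhoffSum shift f m u) * partitionFun f n u * (ψ u - κ) := by ring
    _ ≤ Real.exp (birkhoffSum shift f m u) * partitionFun f n u * ψ v := by
        have := partitionFun_pos f n u
        gcongr
        linarith
    _ ≤ (Real.exp (ε 0) * Real.exp (birkhoffSum shift f m v)) *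
          (Real.exp (ε 0) * partitionFun f n v) * ψ v := by
        have := partitionFun_pos f n u
        have := hψ v
        gcongr
    _ = _ := by ring

theorem normalizedIterate_minorization {n m : ℕ} {φ ψ : Conf → ℝ} (hψ : ∀ x, 0 ≤ ψ x) {κ : ℝ}
    (hκ : ∀ u v, Agree m u v → |ψ u - ψ v| ≤ κ)
    (hφ : φ = (fun u => partitionFun f n u * ψ u)) (x y : Conf) :
    (ruelle f)^[m] φ y / partitionFun f (m + n) y - κ ≤
      Real.exp (ε 0) ^ 3 * ((ruelle f)^[m] φ x / partitionFun f (m + n) x) := by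
  subst hφ
  have h1 := hf.ruelle_iterate_minorization (n := n) hψ hκ x y
  have h2 := hf.partitionFun_le (m + n) (Agree.zero x y)
  have hx := partitionFun_pos f (m + n) x
  have hy := partitionFun_pos f (m + n) y
  set φ := fun u => partitionFun f n u * ψ u
  have h0 : 0 ≤ (ruelle f)^[m] φ x / partitionFun f (m + n) x := by
    refine div_nonneg ?_ hx.le
    have := ruelle_iterate_mono f m (φ := fun u => 0 * φ u) (ψ := φ) (fun u => by
      rw [zero_mul]; exact mul_nonneg (partitionFun_pos f n u).le (hψ u)) x
    rwa [ruelle_iterate_const_mul, zero_mul] at this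
  rw [div_sub' hy.ne', div_le_iff₀ hy]
  set r := (ruelle f)^[m] φ x / partitionFun f (m + n) x with hr
  have h3 : (ruelle f)^[m] φ x = r * partitionFun f (m + n) x := (div_mul_cancel₀ _ hx.ne').symm
  rw [h3] at h1
  have h4 : Real.exp (ε 0) ^ 2 * (r * partitionFun f (m + n) x) ≤
      Real.exp (ε 0) ^ 2 * (r * (Real.exp (ε 0) * partitionFun f (m + n) y)) := by gcongr
  nlinarith

/-- A Doeblin argument. If the iterate $\rho$ has values in $[a,a+W]$, the minorization is applied
to the nonnegative functions $a+W-\rho$ and $\rho-a$ with the points exchanged. With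
$E=e^{3\varepsilon_0}$, adding the two inequalities bounds $(E+1)$ times the new oscillation by
$(E-1)W+2\kappa$. -/
theorem normalizedIterate_contraction {n m : ℕ} {φ : Conf → ℝ} {W κ : ℝ}
    (hW : ∀ x y, normalizedIterate f n φ x - normalizedIterate f n φ y ≤ W)
    (hκ : ∀ x y, Agree m x y → |normalizedIterate f n φ x - normalizedIterate f n φ y| ≤ κ)
    (x y : Conf) :
    normalizedIterate f (m + n) φ x - normalizedIterate f (m + n) φ y ≤
      (Real.exp (ε 0) ^ 3 - 1) / (Real.exp (ε 0) ^ 3 + 1) * W + κ := by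
  obtain ⟨a, ha⟩ := exists_le_add_of_sub_le hW
  have hsplit : ∀ (p q : ℝ) (z : Conf), (ruelle f)^[m] (fun u => partitionFun f n u *
      (p * normalizedIterate f n φ u + q)) z / partitionFun f (m + n) z =
      p * normalizedIterate f (m + n) φ z + q := by
    intro p q z
    have hz := (partitionFun_pos f (m + n) z).ne'
    have : (fun u => partitionFun f n u * (p * normalizedIterate f n φ u + q)) =
        fun u => p * (ruelle f)^[n] φ u + q * partitionFun f n u := by
      ext u
      rw [ruelle_iterate_eq_mul f n φ u]
      ring
    rw [this, ruelle_iterate_add]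
    simp only [ruelle_iterate_const_mul]
    rw [← partitionFun_add, ← Function.iterate_add_apply, normalizedIterate]
    field_simp
  have h1 := hf.normalizedIterate_minorization (n := n) (m := m)
    (ψ := fun u => (-1) * normalizedIterate f n φ u + (a + W)) (fun u => by linarith [(ha u).2])
    (κ := κ) (fun u v huv => by
      rw [show ∀ r s t : ℝ, (-1) * r + s - ((-1) * t + s) = -(r - t) from fun _ _ _ => by ring,
        abs_neg]
      exact hκ u v huv) rfl x y
  have h2 := hf.normalizedIterate_minorization (n := n) (m := m)
    (ψ := fun u => 1 * normalizedIterate f n φ u + (-a)) (fun u => by linarith [(ha u).1])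
    (κ := κ) (fun u v huv => by
      rw [show ∀ r s t : ℝ, 1 * r + s - (1 * t + s) = r - t from fun _ _ _ => by ring]
      exact hκ u v huv) rfl y x
  rw [hsplit, hsplit] at h1 h2
  have hE : 1 ≤ Real.exp (ε 0) ^ 3 := one_le_pow₀ (Real.one_le_exp (hf.nonneg 0))
  have hκ0 : 0 ≤ κ := (abs_nonneg _).trans (hκ x x fun _ _ => rfl)
  set E := Real.exp (ε 0) ^ 3
  rw [div_mul_eq_mul_div, div_add' _ _ _ (by positivity), le_div_iff₀ (by positivity)]
  nlinarith

/-- Normalized iterates converge, at a speed that depends on the modulus of continuity only. -/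
theorem normalizedIterate_uniformCauchy (B : ℝ) {v : ℕ → ℝ} (hv : Tendsto v atTop (𝓝 0))
    {e : ℝ} (he : 0 < e) : ∃ N : ℕ, ∀ φ : Conf → ℝ, (∀ x, |φ x| ≤ B) →
      (∀ M x y, Agree M x y → |φ x - φ y| ≤ v M) → ∀ n, N ≤ n → ∀ k x y,
        |normalizedIterate f (n + k) φ x - normalizedIterate f n φ y| ≤ e := by
  set E := Real.exp (ε 0) ^ 3
  have hE : 1 ≤ E := one_le_pow₀ (Real.one_le_exp (hf.nonneg 0))
  set θ := (E - 1) / (E + 1) with hθdef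
  have hθ0 : 0 ≤ θ := div_nonneg (by linarith) (by linarith)
  have hθ1 : θ < 1 := (div_lt_one (by linarith)).2 (by linarith)
  have hw : Tendsto (fun N => Real.exp (ε 0) * (v N + (Real.exp (ε N) - 1) * B) +
      (Real.exp (ε N) - 1) * B) atTop (𝓝 0) := by
    have h1 : Tendsto (fun N => (Real.exp (ε N) - 1) * B) atTop (𝓝 0) := by
      have := (((Real.continuous_exp.tendsto 0).comp hf.tendsto).sub_const 1).mul_const B
      simpa using this
    simpa using ((hv.add h1).const_mul (Real.exp (ε 0))).add h1
  -- With this error per block of length `m`, the affine recursion for the oscillation has a fixed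
  -- point at most `e / 2`; `j` blocks then make the transient part smaller than `e / 2`.
  obtain ⟨m, hm⟩ := (hw.eventually_lt_const
    (mul_pos (half_pos he) (sub_pos.2 hθ1))).exists
  have hpow : Tendsto (fun j => θ ^ j * (2 * B)) atTop (𝓝 0) := by
    simpa using (tendsto_pow_atTop_nhds_zero_of_lt_one hθ0 hθ1).mul_const (2 * B)
  obtain ⟨j, hj⟩ := (hpow.eventually_lt_const (half_pos he)).exists
  refine ⟨j * m, fun φ hB hmod n hn k x y => ?_⟩
  have claim : ∀ j n, j * m ≤ n → ∀ x y,
      normalizedIterate f n φ x - normalizedIterate f n φ y ≤ θ ^ j * (2 * B) + e / 2 := by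
    intro j
    induction j with
    | zero =>
      intro n _ x y
      have h1 := abs_le.1 (abs_normalizedIterate_le f hB n x)
      have h2 := abs_le.1 (abs_normalizedIterate_le f hB n y)
      linarith [h1.2, h2.1]
    | succ j ih =>
      intro n hn x y
      have hmn : m ≤ n := le_trans (by nlinarith) hn
      have := hf.normalizedIterate_contraction (n := n - m) (m := m) (φ := φ)
        (ih (n - m) (by
          rw [add_mul, one_mul] at hn
          omega)) (fun x y hxy => hf.normalizedIterate_sub_le hB (hmod m) (n - m) hxy) x y
      rw [Nat.add_sub_cancel' hmn] at this
      change _ ≤ θ * (θ ^ j * (2 * B) + e / 2) + _ at this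
      have heq : θ ^ (j + 1) * (2 * B) + e / 2 =
        θ * (θ ^ j * (2 * B) + e / 2) + e / 2 * (1 - θ) := by ring
      linarith
  obtain ⟨a, ha⟩ := exists_le_add_of_sub_le (W := e) (ρ := normalizedIterate f n φ)
    fun x y => (claim j n hn x y).trans (by linarith)
  have h1 := normalizedIterate_mem_Icc f ha k x
  have h2 := ha y
  rw [abs_le]
  constructor <;> linarith [h1.1, h1.2, h2.1, h2.2]

end HasDistortion

/-! ### The Ruelle-Perron-Frobenius theorem. -/

theorem _root_.Continuous.integrable_conf {E : Type*} [NormedAddCommGroup E]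
    {φ : Conf → E} (hφ : Continuous φ) (ν : Measure Conf) [IsFiniteMeasure ν] :
    Integrable φ ν := by
  obtain ⟨B, -, hB⟩ := exists_norm_bound hφ
  exact Integrable.of_bound hφ.aestronglyMeasurable B (Eventually.of_forall hB)

/-- The limit of the normalized iterates at a reference configuration. -/
noncomputable def ratioLimit (f φ : Conf → ℝ) : ℝ :=
  limUnder atTop fun n => normalizedIterate f n φ allUp

theorem normalizedIterate_add (f : Conf → ℝ) (n : ℕ) (φ ψ : Conf → ℝ) (x : Conf) :
    normalizedIterate f n (fun x => φ x + ψ x) x =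
      normalizedIterate f n φ x + normalizedIterate f n ψ x := by
  simp only [normalizedIterate, ruelle_iterate_add, add_div]

theorem normalizedIterate_const_mul (f : Conf → ℝ) (n : ℕ) (c : ℝ) (φ : Conf → ℝ) (x : Conf) :
    normalizedIterate f n (fun x => c * φ x) x = c * normalizedIterate f n φ x := by
  simp only [normalizedIterate, ruelle_iterate_const_mul, mul_div_assoc]

namespace HasDistortion

variable {f : Conf → ℝ} {ε : ℕ → ℝ} (hf : HasDistortion f ε)
include hf

theorem tendstoUniformly_ratioLimit {φ : Conf → ℝ} (hφ : Continuous φ) :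
    TendstoUniformly (fun n => normalizedIterate f n φ) (fun _ => ratioLimit f φ) atTop := by
  obtain ⟨v, hv, hmod⟩ := exists_modulus hφ
  obtain ⟨B, -, hB⟩ := exists_norm_bound hφ
  have key : ∀ e : ℝ, 0 < e → ∃ N, ∀ n, N ≤ n → ∀ k x y,
      |normalizedIterate f (n + k) φ x - normalizedIterate f n φ y| ≤ e := fun e he => by
    obtain ⟨N, hN⟩ := hf.normalizedIterate_uniformCauchy B hv he
    exact ⟨N, hN φ hB hmod⟩
  have hc : CauchySeq fun n => normalizedIterate f n φ allUp := by
    refine Metric.cauchySeq_iff'.2 fun e he => ?_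
    obtain ⟨N, hN⟩ := key (e / 2) (half_pos he)
    refine ⟨N, fun n hn => ?_⟩
    have := hN N le_rfl (n - N) allUp allUp
    rw [Nat.add_sub_cancel' hn] at this
    rw [Real.dist_eq]
    linarith
  have hlim : Tendsto (fun n => normalizedIterate f n φ allUp) atTop (𝓝 (ratioLimit f φ)) :=
    hc.tendsto_limUnder
  refine Metric.tendstoUniformly_iff.2 fun e he => ?_
  obtain ⟨N, hN⟩ := key (e / 2) (half_pos he)
  filter_upwards [eventually_ge_atTop N] with n hn x
  have h1 : Tendsto (fun k => |normalizedIterate f (n + k) φ allUp - normalizedIterate f n φ x|)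
      atTop (𝓝 |ratioLimit f φ - normalizedIterate f n φ x|) := by
    refine ((hlim.comp (tendsto_add_atTop_nat n)).sub_const _).abs.congr fun k => ?_
    simp [add_comm]
  rw [Real.dist_eq]
  exact (le_of_tendsto' h1 fun k => hN n hn k _ _).trans_lt (half_lt_self he)

theorem tendsto_ratioLimit {φ : Conf → ℝ} (hφ : Continuous φ) (x : Conf) :
    Tendsto (fun n => normalizedIterate f n φ x) atTop (𝓝 (ratioLimit f φ)) :=
  (hf.tendstoUniformly_ratioLimit hφ).tendsto_at x

/-- The functional `φ ↦ lim L_f^n φ / L_f^n 1` is integration against a probability measure. -/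
theorem exists_measure : ∃ ν : Measure Conf, IsProbabilityMeasure ν ∧
    ∀ φ : Conf → ℝ, Continuous φ → ∫ x, φ x ∂ν = ratioLimit f φ := by
  let Λ : CompactlySupportedContinuousMap Conf ℝ →ₚ[ℝ] ℝ := PositiveLinearMap.mk₀
    { toFun := fun φ => ratioLimit f φ
      map_add' := fun φ ψ => by
        refine tendsto_nhds_unique (hf.tendsto_ratioLimit (φ + ψ).continuous allUp)
          (((hf.tendsto_ratioLimit φ.continuous allUp).add
            (hf.tendsto_ratioLimit ψ.continuous allUp)).congr fun n => ?_)
        exact (normalizedIterate_add f n φ ψ allUp).symm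
      map_smul' := fun c φ => by
        refine tendsto_nhds_unique (hf.tendsto_ratioLimit (c • φ).continuous allUp)
          (((hf.tendsto_ratioLimit φ.continuous allUp).const_mul c).congr fun n => ?_)
        exact (normalizedIterate_const_mul f n c φ allUp).symm }
    (fun φ hφ => by
      refine ge_of_tendsto' (hf.tendsto_ratioLimit φ.continuous allUp) fun n => ?_
      refine div_nonneg ?_ (partitionFun_pos f n _).le
      have := ruelle_iterate_mono f n (φ := fun u => 0 * φ u) (ψ := φ)
        (fun u => by rw [zero_mul]; exact hφ u) allUp
      rwa [ruelle_iterate_const_mul, zero_mul] at this)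
  have hΛ : ∀ φ : Conf → ℝ, Continuous φ →
      ∫ x, φ x ∂(RealRMK.rieszMeasure Λ) = ratioLimit f φ := fun φ hφ =>
    RealRMK.integral_rieszMeasure Λ
      (CompactlySupportedContinuousMap.continuousMapEquiv ⟨φ, hφ⟩)
  refine ⟨RealRMK.rieszMeasure Λ, ⟨?_⟩, hΛ⟩
  have h1 := hΛ (fun _ => 1) continuous_const
  have h2 : ratioLimit f (fun _ => 1) = 1 := by
    refine tendsto_nhds_unique (hf.tendsto_ratioLimit continuous_const allUp)
      (tendsto_const_nhds.congr fun n => ?_)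
    exact (div_self (partitionFun_pos f n allUp).ne').symm
  rw [h2, integral_const, smul_eq_mul, mul_one] at h1
  exact (ENNReal.toReal_eq_one_iff _).1 h1

/-- The Ruelle-Perron-Frobenius theorem. -/
theorem exists_isRuelleTriple (hfc : Continuous f) :
    ∃ (lam : ℝ) (h : Conf → ℝ) (ν : Measure Conf), IsRuelleTriple f lam h ν := by
  obtain ⟨ν, hν, hint⟩ := hf.exists_measure
  have hcr : ∀ {φ : Conf → ℝ}, Continuous φ → Continuous (ruelle f φ) :=
    fun hφ => continuous_ruelle hfc hφ
  have hZc : ∀ n, Continuous (partitionFun f n) :=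
    fun n => continuous_ruelle_iterate hfc continuous_const n
  set lam : ℝ := ∫ x, ruelle f (fun _ => 1) x ∂ν with hlam
  set D := Real.exp (ε 0) with hD
  have hD0 : 0 < D := Real.exp_pos _
  have hbound : ∀ (n : ℕ) (x y : Conf), partitionFun f n x ≤ D * partitionFun f n y :=
    fun n x y => hf.partitionFun_le n (Agree.zero x y)
  have hlam0 : 0 < lam := by
    have h1 : ∀ x, partitionFun f 1 allUp / D ≤ ruelle f (fun _ => 1) x := fun x => by
      rw [div_le_iff₀' hD0]
      exact hbound 1 allUp x
    have h2 := integral_mono (integrable_const _) ((hcr continuous_const).integrable_conf ν) h1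
    rw [integral_const] at h2
    have h3 : 0 < partitionFun f 1 allUp / D := div_pos (partitionFun_pos f 1 _) hD0
    simp only [probReal_univ, one_smul] at h2
    linarith
  have heigen : ∀ φ : Conf → ℝ, Continuous φ →
      ∫ x, ruelle f φ x ∂ν = lam * ∫ x, φ x ∂ν := by
    intro φ hφ
    rw [hint _ hφ, hint _ (hcr hφ), hlam, hint _ (hcr continuous_const)]
    -- $L^{n+1}\varphi/L^n1$ is the product of $L^{n+1}1/L^n1$ and $L^{n+1}\varphi/L^{n+1}1$.
    refine tendsto_nhds_unique (hf.tendsto_ratioLimit (hcr hφ) allUp)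
      (((hf.tendsto_ratioLimit (hcr continuous_const) allUp).mul
        ((hf.tendsto_ratioLimit hφ allUp).comp (tendsto_add_atTop_nat 1))).congr fun n => ?_)
    have h1 := (partitionFun_pos f n allUp).ne'
    have h2 := (partitionFun_pos f (n + 1) allUp).ne'
    simp only [Function.comp_apply, normalizedIterate, ← Function.iterate_succ_apply]
    change partitionFun f (n + 1) allUp / _ * _ = _
    field_simp
  have hiter : ∀ n (φ : Conf → ℝ), Continuous φ →
      ∫ x, (ruelle f)^[n] φ x ∂ν = lam ^ n * ∫ x, φ x ∂ν := by
    intro n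
    induction n with
    | zero => intro φ _; simp
    | succ n ih =>
      intro φ hφ
      simp only [Function.iterate_succ_apply]
      rw [ih _ (hcr hφ), heigen _ hφ]
      ring
  set u : ℕ → Conf → ℝ := fun n x => (lam ^ n)⁻¹ * partitionFun f n x with hu
  have hup : ∀ n x, 0 < u n x := fun n x => mul_pos (by positivity) (partitionFun_pos f n x)
  have huc : ∀ n, Continuous (u n) := fun n => continuous_const.mul (hZc n)
  have huint : ∀ n, ∫ x, u n x ∂ν = 1 := fun n => by
    simp only [hu]
    rw [integral_const_mul, partitionFun, hiter n _ continuous_const]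
    have : lam ^ n ≠ 0 := by positivity
    simp [this]
  have hule : ∀ n {N x y}, Agree N x y → u n x ≤ Real.exp (ε N) * u n y := by
    intro n N x y hxy
    have := mul_le_mul_of_nonneg_left (hf.partitionFun_le n hxy)
      (by positivity : (0 : ℝ) ≤ (lam ^ n)⁻¹)
    simp only [hu]
    linarith
  -- The functions `u n` have integral one and values comparable up to the factor `D`; this pins
  -- them between `D⁻¹` and `D`.
  have huD : ∀ n x, u n x ≤ D := fun n x => by
    have := integral_mono (integrable_const (u n x))
      (((huc n).integrable_conf ν).const_mul D) fun y => hule n (Agree.zero x y)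
    rw [integral_const, integral_const_mul, huint] at this
    simpa using this
  have huD' : ∀ n x, D⁻¹ ≤ u n x := fun n x => by
    have := integral_mono ((huc n).integrable_conf ν) (integrable_const (D * u n x))
      fun y => hule n (Agree.zero y x)
    rw [integral_const, huint] at this
    rw [inv_le_iff_one_le_mul₀' hD0]
    simpa using this
  have hmod : ∀ n N x y, Agree N x y → |u n x - u n y| ≤ (Real.exp (ε N) - 1) * D := by
    intro n
    have h1 : ∀ N x y, Agree N x y → u n x - u n y ≤ (Real.exp (ε N) - 1) * D := by
      intro N x y hxy
      have hE : 1 ≤ Real.exp (ε N) := Real.one_le_exp (hf.nonneg N)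
      have := mul_le_mul_of_nonneg_left (huD n y) (sub_nonneg.2 hE)
      linarith [hule n hxy]
    intro N x y hxy
    exact abs_le.2 ⟨by linarith [h1 N y x hxy.symm], h1 N x y hxy⟩
  have hv : Tendsto (fun N => (Real.exp (ε N) - 1) * D) atTop (𝓝 0) := by
    have := (((Real.continuous_exp.tendsto 0).comp hf.tendsto).sub_const 1).mul_const D
    simpa using this
  -- `u (n + m)` is `u n` times the normalized iterate of `u m`, which tends to $\int u_m\,d\nu=1$.
  -- All `u m` share one bound and one modulus, so the speed is uniform in `m`.
  have hcauchy : ∀ e : ℝ, 0 < e → ∃ N, ∀ n, N ≤ n → ∀ m x, |u (n + m) x - u n x| ≤ e := by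
    intro e he
    obtain ⟨N, hN⟩ := hf.normalizedIterate_uniformCauchy D hv (div_pos he hD0)
    refine ⟨N, fun n hn m x => ?_⟩
    have h1 : |1 - normalizedIterate f n (u m) x| ≤ e / D := by
      have hlim := hf.tendsto_ratioLimit (huc m) x
      rw [← hint _ (huc m), huint m] at hlim
      have h2 : Tendsto (fun k => |normalizedIterate f (n + k) (u m) x -
          normalizedIterate f n (u m) x|) atTop (𝓝 |1 - normalizedIterate f n (u m) x|) := by
        refine ((hlim.comp (tendsto_add_atTop_nat n)).sub_const _).abs.congr fun k => ?_
        simp [add_comm]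
      exact le_of_tendsto' h2 fun k => hN (u m)
        (fun x => abs_le.2 ⟨by linarith [hup m x], huD m x⟩) (hmod m) n hn k x x
    have h2 : u (n + m) x = u n x * normalizedIterate f n (u m) x := by
      have hz := (partitionFun_pos f n x).ne'
      simp only [hu, normalizedIterate]
      rw [ruelle_iterate_const_mul, partitionFun_add, pow_add]
      field_simp
    rw [h2, show u n x * normalizedIterate f n (u m) x - u n x =
      -(u n x * (1 - normalizedIterate f n (u m) x)) by ring, abs_neg, abs_mul,
      abs_of_pos (hup n x)]
    calc u n x * |1 - normalizedIterate f n (u m) x| ≤ D * (e / D) :=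
          mul_le_mul (huD n x) h1 (abs_nonneg _) hD0.le
      _ = e := mul_div_cancel₀ _ hD0.ne'
  have hlimex : ∀ x, ∃ l, Tendsto (fun n => u n x) atTop (𝓝 l) := fun x => by
    refine cauchySeq_tendsto_of_complete (Metric.cauchySeq_iff'.2 fun e he => ?_)
    obtain ⟨N, hN⟩ := hcauchy (e / 2) (half_pos he)
    refine ⟨N, fun n hn => ?_⟩
    have := hN N le_rfl (n - N) x
    rw [Nat.add_sub_cancel' hn] at this
    rw [Real.dist_eq]
    linarith
  choose h hh using hlimex
  have hunif : TendstoUniformly u h atTop := by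
    refine Metric.tendstoUniformly_iff.2 fun e he => ?_
    obtain ⟨N, hN⟩ := hcauchy (e / 2) (half_pos he)
    filter_upwards [eventually_ge_atTop N] with n hn x
    have h1 : Tendsto (fun k => |u (n + k) x - u n x|) atTop (𝓝 |h x - u n x|) := by
      refine (((hh x).comp (tendsto_add_atTop_nat n)).sub_const _).abs.congr fun k => ?_
      simp [add_comm]
    rw [Real.dist_eq]
    exact (le_of_tendsto' h1 fun k => hN n hn k x).trans_lt (half_lt_self he)
  refine ⟨lam, h, ν, hlam0, hunif.continuous (Eventually.of_forall huc).frequently,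
    fun x => (inv_pos.2 hD0).trans_le (ge_of_tendsto' (hh x) fun n => huD' n x), hν, fun x => ?_,
    heigen, fun φ hφ => ?_⟩
  · have h1 : Tendsto (fun n => ruelle f (u n) x) atTop (𝓝 (ruelle f h x)) := by
      simp only [ruelle_apply, smul_eq_mul]
      exact (((hh _).const_mul _).add ((hh _).const_mul _)).const_mul _
    refine tendsto_nhds_unique h1
      ((((hh x).comp (tendsto_add_atTop_nat 1)).const_mul lam).congr fun n => ?_)
    have h2 := ruelle_iterate_const_mul f 1 (lam ^ n)⁻¹ (partitionFun f n) x
    rw [← partitionFun_add] at h2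
    simp only [Function.iterate_one] at h2
    simp only [hu, Function.comp_apply]
    rw [h2, add_comm 1 n, pow_succ]
    field_simp
  · have hR := hf.tendstoUniformly_ratioLimit hφ
    rw [← hint _ hφ] at hR
    rw [Metric.tendstoUniformly_iff] at hR hunif ⊢
    intro e he
    set l := ∫ x, φ x ∂ν
    filter_upwards [hR (e / (2 * D)) (by positivity), hunif (e / (2 * (|l| + 1))) (by positivity)]
      with n hn1 hn2 x
    have h1 := hn1 x
    have h2 := hn2 x
    rw [Real.dist_eq] at h1 h2 ⊢
    rw [ruelle_iterate_eq_mul, ← mul_assoc]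
    change |h x * l - u n x * normalizedIterate f n φ x| < e
    rw [show h x * l - u n x * normalizedIterate f n φ x =
      u n x * (l - normalizedIterate f n φ x) + (h x - u n x) * l by ring]
    refine (abs_add_le _ _).trans_lt ?_
    rw [abs_mul (u n x), abs_mul (h x - u n x), abs_of_pos (hup n x)]
    have h3 : u n x * |l - normalizedIterate f n φ x| < e / 2 := by
      calc u n x * |l - normalizedIterate f n φ x| ≤ D * |l - normalizedIterate f n φ x| := by
            gcongr; exact huD n x
        _ < D * (e / (2 * D)) := by gcongr
        _ = e / 2 := by field_simp
    have h4 : |h x - u n x| * |l| ≤ e / 2 := by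
      calc |h x - u n x| * |l| ≤ e / (2 * (|l| + 1)) * (|l| + 1) := by
            gcongr
            linarith
        _ = e / 2 := by field_simp
    linarith

end HasDistortion

theorem exists_isRuelleTriple_isingPotential {α : ℝ} (hα : 2 < α) :
    ∃ (lam : ℝ) (h : Conf → ℝ) (ν : Measure Conf),
      IsRuelleTriple (isingPotential α) lam h ν := by
  obtain ⟨ε, h1, h2⟩ := isingPotential_distortion hα
  exact HasDistortion.exists_isRuelleTriple ⟨h1, h2⟩ (isWalters_isingPotential hα).1

/-! ### The ferromagnetic cone and Griffiths inequalities. -/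

section Ferromagnetic

/-- The closed cone of functions generated by products of spins; a substitute for the positivity
of all correlations in Griffiths' first inequality. -/
inductive Ferro : (Conf → ℝ) → Prop
  | const (c : ℝ) : 0 ≤ c → Ferro fun _ => c
  | coord (i : ℕ) : Ferro fun x => (x i : ℝ)
  | add {φ ψ : Conf → ℝ} : Ferro φ → Ferro ψ → Ferro fun x => φ x + ψ x
  | mul {φ ψ : Conf → ℝ} : Ferro φ → Ferro ψ → Ferro fun x => φ x * ψ x
  | lim {F : ℕ → Conf → ℝ} {φ : Conf → ℝ} : (∀ n, Ferro (F n)) →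
      (∀ x, Tendsto (fun n => F n x) atTop (𝓝 (φ x))) → Ferro φ

namespace Ferro

theorem apply_allUp_nonneg {φ : Conf → ℝ} (hφ : Ferro φ) : 0 ≤ φ allUp := by
  induction hφ with
  | const c hc => exact hc
  | coord i => simp [allUp]
  | add _ _ h1 h2 => exact add_nonneg h1 h2
  | mul _ _ h1 h2 => exact mul_nonneg h1 h2
  | lim _ h1 h2 => exact ge_of_tendsto' (h1 allUp) h2

theorem sum {F : ℕ → Conf → ℝ} (hF : ∀ n, Ferro (F n)) (N : ℕ) :
    Ferro fun x => ∑ n ∈ Finset.range N, F n x := by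
  induction N with
  | zero => simpa using const 0 le_rfl
  | succ N ih => simpa only [Finset.sum_range_succ] using ih.add (hF N)

theorem of_hasSum {F : ℕ → Conf → ℝ} {φ : Conf → ℝ} (hF : ∀ n, Ferro (F n))
    (h : ∀ x, HasSum (fun n => F n x) (φ x)) : Ferro φ :=
  lim (sum hF) fun x => (h x).tendsto_sum_nat

theorem pow {φ : Conf → ℝ} (hφ : Ferro φ) (n : ℕ) : Ferro fun x => φ x ^ n := by
  induction n with
  | zero => simpa using const 1 one_pos.le
  | succ n ih => simpa only [pow_succ] using ih.mul hφ

theorem const_mul {φ : Conf → ℝ} (hφ : Ferro φ) {c : ℝ} (hc : 0 ≤ c) :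
    Ferro fun x => c * φ x := (const c hc).mul hφ

theorem exp {φ : Conf → ℝ} (hφ : Ferro φ) : Ferro fun x => Real.exp (φ x) :=
  of_hasSum (fun n => (hφ.pow n).const_mul (c := (n.factorial : ℝ)⁻¹) (by positivity)) fun x => by
    have := NormedSpace.exp_series_hasSum_exp' (𝕂 := ℝ) (φ x)
    rw [← Real.exp_eq_exp_ℝ] at this
    simpa using this

/-- Only the even part is the preimage average, but the even part of a product contains the product
of the odd parts. The induction therefore carries both. -/
theorem even_odd_parts {φ : Conf → ℝ} (hφ : Ferro φ) :
    Ferro (fun x => (φ (prepend spinUp x) + φ (prepend spinDown x)) / 2) ∧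
      Ferro (fun x => (φ (prepend spinUp x) - φ (prepend spinDown x)) / 2) := by
  induction hφ with
  | const c hc => exact ⟨by simpa using const c hc, by simpa using const 0 le_rfl⟩
  | coord i =>
    cases i with
    | zero =>
      refine ⟨by simpa using const 0 le_rfl, ?_⟩
      convert const 1 one_pos.le using 2
      simp only [prepend_zero, coe_spinUp, coe_spinDown]
      norm_num
    | succ i => exact ⟨by simpa using coord i, by simpa using const 0 le_rfl⟩
  | add _ _ h1 h2 =>
    constructor
    · convert h1.1.add h2.1 using 2
      ring
    · convert h1.2.add h2.2 using 2
      ring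
  | mul _ _ h1 h2 =>
    constructor
    · convert (h1.1.mul h2.1).add (h1.2.mul h2.2) using 2
      ring
    · convert (h1.1.mul h2.2).add (h1.2.mul h2.1) using 2
      ring
  | lim _ h ih =>
    exact ⟨lim (fun n => (ih n).1) fun x => ((h _).add (h _)).div_const 2,
      lim (fun n => (ih n).2) fun x => ((h _).sub (h _)).div_const 2⟩

theorem preimageAvg {φ : Conf → ℝ} (hφ : Ferro φ) : Ferro (preimageAvg φ) := by
  convert hφ.even_odd_parts.1 using 2
  simp only [WaltersIsing.preimageAvg, smul_eq_mul]
  ring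

theorem ruelle_iterate {f φ : Conf → ℝ} (hf : Ferro f) (hφ : Ferro φ) (n : ℕ) :
    Ferro ((ruelle f)^[n] φ) := by
  induction n with
  | zero => exact hφ
  | succ n ih =>
    rw [Function.iterate_succ_apply', ruelle_eq_preimageAvg]
    exact (hf.exp.mul ih).preimageAvg

end Ferro

variable {α : ℝ}

theorem ferro_isingPotential (hα : 1 < α) : Ferro (isingPotential α) :=
  Ferro.of_hasSum (fun k => by
    convert ((Ferro.coord 0).mul (Ferro.coord (k + 1))).const_mul
      (c := (((k : ℝ) + 2) ^ α)⁻¹) (by positivity) using 2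
    rw [div_eq_inv_mul]) (isingPotential_hasSum hα)

/-- The Ising potential without the interaction of the spins `x 0` and `x (k + 1)`. -/
theorem ferro_isingPotential_sub (hα : 1 < α) (k : ℕ) :
    Ferro fun x => isingPotential α x - (((k : ℝ) + 2) ^ α)⁻¹ * ((x 0 : ℝ) * (x (k + 1) : ℝ)) := by
  refine Ferro.of_hasSum (F := fun i x => if i = k then 0 else
    (x 0 : ℝ) * (x (i + 1) : ℝ) / ((i : ℝ) + 2) ^ α) (fun i => ?_) fun x => ?_
  · split_ifs
    · exact Ferro.const 0 le_rfl
    · convert ((Ferro.coord 0).mul (Ferro.coord (i + 1))).const_mul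
        (c := (((i : ℝ) + 2) ^ α)⁻¹) (by positivity) using 2
      rw [div_eq_inv_mul]
  · have h := (isingPotential_hasSum hα x).update k 0
    rw [zero_sub, div_eq_inv_mul, neg_add_eq_sub] at h
    refine (congrArg (HasSum · _) (funext fun i => ?_)).mp h
    by_cases hi : i = k
    · subst hi; simp
    · rw [Function.update_of_ne hi, if_neg hi]

/-- Griffiths' comparison with the system in which only one bond is present. -/
theorem ferro_ruelle_bond (hα : 1 < α) (k : ℕ) {φ : Conf → ℝ} (hφ : Ferro φ) :
    Ferro (ruelle (isingPotential α) fun x =>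
      ((x 0 : ℝ) * (x (k + 1) : ℝ) - Real.tanh (((k : ℝ) + 2) ^ α)⁻¹) * φ x) := by
  set J : ℝ := (((k : ℝ) + 2) ^ α)⁻¹
  rw [ruelle_eq_preimageAvg]
  have hc := Real.cosh_pos J
  have h := ((((ferro_isingPotential_sub hα k).exp.mul ((Ferro.coord 0).mul
    (Ferro.coord (k + 1)))).const_mul (inv_nonneg.2 hc.le)).mul hφ).preimageAvg
  convert h using 3 with x
  rw [smul_eq_mul, ← mul_assoc]
  congr 1
  -- For $b=\pm1$, $e^{Jb}(b-\tanh J)=b/\cosh J$. So removing the bond from the exponent leaves only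
  -- factors in the cone.
  have hb : (x 0 : ℝ) * (x (k + 1) : ℝ) = 1 ∨ (x 0 : ℝ) * (x (k + 1) : ℝ) = -1 := by
    rcases spin_eq (x 0) with h0 | h0 <;> rcases spin_eq (x (k + 1)) with h1 | h1 <;>
      simp [h0, h1]
  rw [Real.exp_sub, Real.tanh_eq_sinh_div_cosh]
  change Real.exp _ * _ = _ * (Real.exp _ / Real.exp (J * _) * _)
  have hs := Real.cosh_sub_sinh J
  have ha := Real.cosh_add_sinh J
  rw [Real.exp_neg] at hs
  rcases hb with hb | hb
  · rw [hb, mul_one, show (1 : ℝ) - Real.sinh J / Real.cosh J =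
      (Real.cosh J - Real.sinh J) / Real.cosh J by field_simp, hs]
    field_simp
  · rw [hb, mul_neg_one, mul_neg_one, Real.exp_neg, show (-1 : ℝ) - Real.sinh J / Real.cosh J =
      -(Real.cosh J + Real.sinh J) / Real.cosh J by field_simp; ring, ha]
    field_simp

theorem le_tanh_coupling (hα : 0 ≤ α) (k : ℕ) :
    (Real.cosh 1)⁻¹ * (((k : ℝ) + 2) ^ α)⁻¹ ≤ Real.tanh (((k : ℝ) + 2) ^ α)⁻¹ := by
  have h1 : (1 : ℝ) ≤ ((k : ℝ) + 2) ^ α :=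
    Real.one_le_rpow (by linarith [(Nat.cast_nonneg k : (0 : ℝ) ≤ k)]) hα
  set J : ℝ := (((k : ℝ) + 2) ^ α)⁻¹
  have hJ0 : 0 ≤ J := by positivity
  have hJ1 : J ≤ 1 := inv_le_one_of_one_le₀ h1
  rw [Real.tanh_eq_sinh_div_cosh, inv_mul_eq_div]
  have h2 : Real.cosh J ≤ Real.cosh 1 := Real.cosh_le_cosh.2 (by
    rwa [abs_of_nonneg hJ0, abs_one])
  exact div_le_div₀ (Real.sinh_nonneg_iff.2 hJ0) (Real.self_le_sinh_iff.2 hJ0)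
    (Real.cosh_pos J) h2

end Ferromagnetic

/-! ### Spin flip symmetry. -/

section Flip

/-- The opposite spin. -/
def flipSpin (a : Spin) : Spin :=
  ⟨-a, by rcases a with ⟨a, rfl | rfl⟩ <;> simp⟩

/-- The spin flip `x ↦ -x`. -/
def flip (x : Conf) : Conf := fun n => flipSpin (x n)

@[simp] theorem coe_flip (x : Conf) (n : ℕ) : (flip x n : ℝ) = -(x n : ℝ) := rfl

theorem flipSpin_up : flipSpin spinUp = spinDown := Subtype.ext rfl

theorem flipSpin_down : flipSpin spinDown = spinUp := Subtype.ext (neg_neg 1)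

theorem flip_prepend (a : Spin) (x : Conf) : flip (prepend a x) = prepend (flipSpin a) (flip x) :=
  funext fun n => by cases n <;> rfl

theorem continuous_flip : Continuous flip :=
  continuous_pi fun n => by
    have : Continuous flipSpin := continuous_of_discreteTopology
    exact this.comp (continuous_apply n)

theorem isingPotential_flip (α : ℝ) (x : Conf) :
    isingPotential α (flip x) = isingPotential α x := by
  simp [isingPotential]

theorem ruelle_comp_flip {E : Type*} [NormedAddCommGroup E] [NormedSpace ℝ E] [CompleteSpace E]
    {f : Conf → ℝ} (hf : ∀ x, f (flip x) = f x) (φ : Conf → E) (x : Conf) :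
    ruelle f (fun x => φ (flip x)) x = ruelle f φ (flip x) := by
  rw [ruelle_apply, ruelle_apply, flip_prepend, flip_prepend, flipSpin_up, flipSpin_down,
    ← hf (prepend spinDown x), ← hf (prepend spinUp x), flip_prepend, flip_prepend, flipSpin_up,
    flipSpin_down, add_comm]

theorem ruelle_iterate_comp_flip {f : Conf → ℝ} (hf : ∀ x, f (flip x) = f x) (n : ℕ)
    (φ : Conf → ℝ) (x : Conf) :
    (ruelle f)^[n] (fun x => φ (flip x)) x = (ruelle f)^[n] φ (flip x) := by
  induction n generalizing x with
  | zero => rfl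
  | succ n ih =>
    rw [Function.iterate_succ_apply', Function.iterate_succ_apply', funext ih,
      ruelle_comp_flip hf]

end Flip

theorem continuous_coord (i : ℕ) : Continuous fun x : Conf => (x i : ℝ) :=
  continuous_subtype_val.comp (continuous_apply i)

theorem continuous_firstSpin : Continuous firstSpin := continuous_coord 0

/-! ### Consequences of the Ruelle-Perron-Frobenius data. -/

namespace IsRuelleTriple

variable {f : Conf → ℝ} {lam : ℝ} {h : Conf → ℝ} {ν : Measure Conf} (hr : IsRuelleTriple f lam h ν)
include hr

theorem tendsto_apply {φ : Conf → ℝ} (hφ : Continuous φ) (x : Conf) :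
    Tendsto (fun n : ℕ => (lam ^ n)⁻¹ * (ruelle f)^[n] φ x) atTop (𝓝 (h x * ∫ y, φ y ∂ν)) :=
  (hr.tendsto φ hφ).tendsto_at x

theorem tendsto_one (x : Conf) :
    Tendsto (fun n : ℕ => (lam ^ n)⁻¹ * (ruelle f)^[n] (fun _ => 1) x) atTop (𝓝 (h x)) := by
  have := hr.isProbabilityMeasure
  simpa using hr.tendsto_apply continuous_const x (φ := fun _ => 1)

/-- A continuous eigenfunction for the leading eigenvalue is a multiple of `h`. -/
theorem eq_mul_integral {φ : Conf → ℝ} (hφ : Continuous φ) (he : ∀ x, ruelle f φ x = lam * φ x)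
    (x : Conf) : φ x = h x * ∫ y, φ y ∂ν := by
  refine tendsto_nhds_unique (tendsto_const_nhds.congr fun n => ?_) (hr.tendsto_apply hφ x)
  have : (ruelle f)^[n] φ x = lam ^ n * φ x := by
    induction n generalizing x with
    | zero => simp
    | succ n ih =>
      rw [Function.iterate_succ_apply, funext he, ruelle_iterate_const_mul, ih, pow_succ]
      ring
  rw [this, inv_mul_cancel_left₀ (pow_ne_zero n hr.lam_pos.ne')]

theorem ruelle_iterate_eigenfunction (n : ℕ) (x : Conf) :
    (ruelle f)^[n] h x = lam ^ n * h x := by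
  induction n generalizing x with
  | zero => simp
  | succ n ih =>
    rw [Function.iterate_succ_apply, funext hr.eigenfunction, ruelle_iterate_const_mul, ih,
      pow_succ]
    ring

theorem integral_eigenfunction : ∫ x, h x ∂ν = 1 := by
  have := hr.eq_mul_integral hr.continuous hr.eigenfunction allUp
  exact (mul_right_eq_self₀.1 this.symm).resolve_right (hr.pos _).ne'

/-- By compactness `h` lies between two positive constants, and $\lambda^{-n}L^n$ fixes `h` and is
monotone. -/
theorem exists_partitionFun_bounds : ∃ c C : ℝ, 0 < c ∧ 0 < C ∧ ∀ n x,
    c ≤ (lam ^ n)⁻¹ * (ruelle f)^[n] (fun _ => 1) x ∧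
      (lam ^ n)⁻¹ * (ruelle f)^[n] (fun _ => 1) x ≤ C := by
  obtain ⟨p, -, hp⟩ := isCompact_univ.exists_isMinOn ⟨allUp, Set.mem_univ _⟩
    hr.continuous.continuousOn
  obtain ⟨q, -, hq⟩ := isCompact_univ.exists_isMaxOn ⟨allUp, Set.mem_univ _⟩
    hr.continuous.continuousOn
  have hp' : ∀ x, h p ≤ h x := fun x => hp (Set.mem_univ x)
  have hq' : ∀ x, h x ≤ h q := fun x => hq (Set.mem_univ x)
  have hp0 := hr.pos p
  have hq0 := hr.pos q
  refine ⟨h p / h q, h q / h p, by positivity, by positivity, fun n x => ?_⟩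
  have hl : 0 < lam ^ n := pow_pos hr.lam_pos n
  have h1 := ruelle_iterate_mono f n (φ := h) (ψ := fun _ => h q * 1)
    (fun x => by simpa using hq' x) x
  have h2 := ruelle_iterate_mono f n (φ := fun _ => h p * 1) (ψ := h)
    (fun x => by simpa using hp' x) x
  rw [hr.ruelle_iterate_eigenfunction, ruelle_iterate_const_mul f n _ fun _ => 1] at h1 h2
  constructor
  · rw [le_inv_mul_iff₀ hl, mul_div_assoc', div_le_iff₀' hq0]
    exact (mul_le_mul_of_nonneg_left (hp' x) hl.le).trans h1
  · rw [inv_mul_le_iff₀ hl, mul_div_assoc', le_div_iff₀' hp0]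
    exact h2.trans (mul_le_mul_of_nonneg_left (hq' x) hl.le)

theorem integral_gibbsMeasure (φ : Conf → ℝ) :
    ∫ x, φ x ∂(gibbsMeasure h ν) = ∫ x, h x * φ x ∂ν := by
  rw [gibbsMeasure, integral_withDensity_eq_integral_toReal_smul
    hr.continuous.measurable.ennreal_ofReal (Eventually.of_forall fun _ => ENNReal.ofReal_lt_top)]
  simp only [ENNReal.toReal_ofReal (hr.pos _).le, smul_eq_mul]

theorem eigenfunction_flip (hf : ∀ x, f (flip x) = f x) (x : Conf) : h (flip x) = h x :=
  tendsto_nhds_unique (hr.tendsto_one (flip x))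
    ((hr.tendsto_one x).congr fun n => by
      rw [← ruelle_iterate_comp_flip hf])

theorem integral_comp_flip (hf : ∀ x, f (flip x) = f x) {φ : Conf → ℝ} (hφ : Continuous φ) :
    ∫ x, φ (flip x) ∂ν = ∫ x, φ x ∂ν := by
  refine mul_left_cancel₀ (hr.pos allUp).ne' (tendsto_nhds_unique
    (hr.tendsto_apply (hφ.comp continuous_flip) allUp) ?_)
  rw [← hr.eigenfunction_flip hf]
  exact (hr.tendsto_apply hφ _).congr fun n => by
    rw [← ruelle_iterate_comp_flip hf]
    rfl

theorem integral_eq_zero_of_odd (hf : ∀ x, f (flip x) = f x) {φ : Conf → ℝ} (hφ : Continuous φ)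
    (hodd : ∀ x, φ (flip x) = -φ x) : ∫ x, φ x ∂ν = 0 := by
  have := hr.integral_comp_flip hf hφ
  simp only [hodd, integral_neg] at this
  linarith

theorem ferro_eigenfunction (hf : Ferro f) : Ferro h :=
  Ferro.lim (fun n => (hf.ruelle_iterate (Ferro.const 1 one_pos.le) n).const_mul
    (inv_nonneg.2 (pow_nonneg hr.lam_pos.le n))) hr.tendsto_one

/-- Up to the factor `h allUp`, the integral is a limit of $\lambda^{-n}L^n\varphi$ at the all-up
configuration, where members of the cone are nonnegative. -/
theorem integral_nonneg_of_ferro (hf : Ferro f) {φ : Conf → ℝ} (hφ : Continuous φ)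
    (hφF : Ferro φ) : 0 ≤ ∫ x, φ x ∂ν := by
  refine nonneg_of_mul_nonneg_right (a := h allUp) ?_ (hr.pos allUp)
  refine ge_of_tendsto' (hr.tendsto_apply hφ allUp) fun n => ?_
  exact mul_nonneg (inv_nonneg.2 (pow_nonneg hr.lam_pos.le n))
    (hf.ruelle_iterate hφF n).apply_allUp_nonneg

end IsRuelleTriple

/-! ### Power law lower bounds for correlations and iterates. -/

section Correlation

variable {α : ℝ} {lam : ℝ} {h : Conf → ℝ} {ν : Measure Conf}

/-- The bond comparison is applied to `h`, itself a limit of members of the cone. Integrating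
against `ν` removes the operator at the price of the factor `lam`. -/
theorem correlation_firstSpin_ge (hα : 2 < α) (hr : IsRuelleTriple (isingPotential α) lam h ν)
    (k : ℕ) : Real.tanh (((k : ℝ) + 2) ^ α)⁻¹ ≤
      correlation firstSpin firstSpin (gibbsMeasure h ν) (k + 1) := by
  have := hr.isProbabilityMeasure
  have hα1 : 1 < α := by linarith
  have hc := (isWalters_isingPotential hα).1
  have hF := ferro_isingPotential hα1
  set t := Real.tanh (((k : ℝ) + 2) ^ α)⁻¹
  have hodd : ∫ x, h x * firstSpin x ∂ν = 0 := by
    refine hr.integral_eq_zero_of_odd (isingPotential_flip α)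
      (hr.continuous.mul continuous_firstSpin) fun x => ?_
    rw [hr.eigenfunction_flip (isingPotential_flip α)]
    simp [firstSpin]
  rw [correlation, hr.integral_gibbsMeasure, hr.integral_gibbsMeasure, hodd, mul_zero, sub_zero]
  have hcont : Continuous fun x : Conf => ((x 0 : ℝ) * (x (k + 1) : ℝ) - t) * h x :=
    (((continuous_coord 0).mul (continuous_coord (k + 1))).sub continuous_const).mul hr.continuous
  have h1 := hr.integral_nonneg_of_ferro hF (continuous_ruelle hc hcont)
    (ferro_ruelle_bond hα1 k (hr.ferro_eigenfunction hF))
  rw [hr.eigenmeasure _ hcont] at h1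
  have h2 := nonneg_of_mul_nonneg_right h1 hr.lam_pos
  have h3 : ∀ x : Conf, ((x 0 : ℝ) * (x (k + 1) : ℝ) - t) * h x =
      h x * (firstSpin (shift^[k + 1] x) * firstSpin x) - t * h x := fun x => by
    simp only [firstSpin, shift_iterate_apply, zero_add]
    ring
  simp only [h3] at h2
  rw [integral_sub, integral_const_mul, hr.integral_eigenfunction] at h2
  · linarith
  · refine Continuous.integrable_conf (hr.continuous.mul
      ((continuous_firstSpin.comp ?_).mul continuous_firstSpin)) ν
    exact continuous_shift.iterate (k + 1)
  · exact (hr.continuous.integrable_conf ν).const_mul t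

theorem correlation_firstSpin_power_law (hα : 2 < α)
    (hr : IsRuelleTriple (isingPotential α) lam h ν) :
    ∃ C : ℝ, 0 < C ∧ ∀ n : ℕ, 1 ≤ n →
      C / (n : ℝ) ^ α ≤ correlation firstSpin firstSpin (gibbsMeasure h ν) n := by
  have hc := Real.cosh_pos 1
  refine ⟨(Real.cosh 1)⁻¹ / 2 ^ α, by positivity, fun n hn => ?_⟩
  obtain ⟨k, rfl⟩ := Nat.exists_eq_add_of_le' hn
  refine le_trans ?_ ((le_tanh_coupling (by linarith) k).trans (correlation_firstSpin_ge hα hr k))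
  rw [div_div, ← Real.mul_rpow (by norm_num) (by positivity), ← div_eq_mul_inv]
  have hk : (0 : ℝ) ≤ k := Nat.cast_nonneg k
  gcongr
  push_cast
  linarith

/-- After `k + 1` iterations the spin `x (k + 1)` is the first spin of the base point, so it factors
out and equals one at the all-up configuration. -/
theorem ruelle_iterate_firstSpin_ge (hα : 2 < α) (k : ℕ) :
    Real.tanh (((k : ℝ) + 2) ^ α)⁻¹ *
        (ruelle (isingPotential α))^[k + 1] (fun _ => 1) allUp ≤
      (ruelle (isingPotential α))^[k + 1] firstSpin allUp := by
  have hα1 : 1 < α := by linarith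
  have h1 := ((ferro_isingPotential hα1).ruelle_iterate
    (ferro_ruelle_bond hα1 k (Ferro.const 1 one_pos.le)) k).apply_allUp_nonneg
  rw [← Function.iterate_succ_apply] at h1
  set t := Real.tanh (((k : ℝ) + 2) ^ α)⁻¹
  have h3 : ∀ x : Conf, ((x 0 : ℝ) * (x (k + 1) : ℝ) - t) * 1 =
      firstSpin (shift^[k + 1] x) * firstSpin x - t * 1 := fun x => by
    simp only [firstSpin, shift_iterate_apply, zero_add]
    ring
  simp only [h3] at h1
  rw [ruelle_iterate_sub] at h1
  change 0 ≤ (ruelle _)^[k + 1] _ allUp - (ruelle _)^[k + 1] _ allUp at h1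
  rw [ruelle_iterate_mul_comp_shift] at h1
  simp only [ruelle_iterate_const_mul _ _ t fun _ => 1] at h1
  have h4 : firstSpin allUp = 1 := rfl
  rw [h4, one_mul] at h1
  linarith

theorem normalized_firstSpin_power_law (hα : 2 < α)
    (hr : IsRuelleTriple (isingPotential α) lam h ν) :
    ∃ c : ℝ, 0 < c ∧ ∀ n : ℕ, c / ((n : ℝ) + 1) ^ α ≤
      (lam ^ n)⁻¹ * (ruelle (isingPotential α))^[n] firstSpin allUp := by
  obtain ⟨c, C, hc, -, hb⟩ := hr.exists_partitionFun_bounds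
  have hcosh := Real.cosh_pos 1
  refine ⟨min 1 ((Real.cosh 1)⁻¹ * c), by positivity, fun n => ?_⟩
  rcases n with _ | k
  · simp [firstSpin, allUp]
  · have h1 := ruelle_iterate_firstSpin_ge hα k
    have h2 := le_tanh_coupling (by linarith : 0 ≤ α) k
    have h3 := (hb (k + 1) allUp).1
    have hl : 0 ≤ (lam ^ (k + 1))⁻¹ := inv_nonneg.2 (pow_nonneg hr.lam_pos.le _)
    calc min 1 ((Real.cosh 1)⁻¹ * c) / (((k + 1 : ℕ) : ℝ) + 1) ^ α
        ≤ (Real.cosh 1)⁻¹ * c / (((k + 1 : ℕ) : ℝ) + 1) ^ α := by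
          gcongr
          exact min_le_right _ _
      _ = (Real.cosh 1)⁻¹ * (((k : ℝ) + 2) ^ α)⁻¹ * c := by
          push_cast
          rw [show (k : ℝ) + 1 + 1 = k + 2 by ring]
          ring
      _ ≤ Real.tanh (((k : ℝ) + 2) ^ α)⁻¹ *
          ((lam ^ (k + 1))⁻¹ * (ruelle (isingPotential α))^[k + 1] (fun _ => 1) allUp) :=
          mul_le_mul h2 h3 hc.le (le_trans (by positivity) h2)
      _ ≤ _ := by
          have := mul_le_mul_of_nonneg_left h1 hl
          linarith

theorem integral_firstSpin (hr : IsRuelleTriple (isingPotential α) lam h ν) :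
    ∫ x, firstSpin x ∂ν = 0 :=
  hr.integral_eq_zero_of_odd (isingPotential_flip α) continuous_firstSpin fun x => by
    simp [firstSpin]

theorem isWalters_comp_firstSpin {E : Type*} [NormedAddCommGroup E] (F : ℝ → E) :
    IsWalters fun x => F (firstSpin x) := by
  refine isWalters_iff_agree.2 fun ε hε => ⟨0, fun n x y hxy => ?_⟩
  have : birkhoffSum shift (fun x => F (firstSpin x)) n x =
      birkhoffSum shift (fun x => F (firstSpin x)) n y := by
    refine Finset.sum_congr rfl fun k hk => ?_
    simp only [firstSpin, shift_iterate_apply, zero_add]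
    rw [hxy k (by simpa using hk)]
  simpa [this] using hε.le

theorem not_exponential_convergence (hα : 2 < α)
    (hr : IsRuelleTriple (isingPotential α) lam h ν) (s : ℝ) :
    ¬ ∃ A τ : ℝ, 0 < τ ∧ τ < 1 ∧ ∀ n : ℕ, 1 ≤ n → ∀ φ : Conf → ℝ, IsWalters φ → ∀ x : Conf,
      |(lam ^ n)⁻¹ * (ruelle (isingPotential α))^[n] φ x - h x * ∫ y, φ y ∂ν| ≤
        A * τ ^ n * waltersNorm s φ := by
  rintro ⟨A, τ, hτ, hτ1, hA⟩
  obtain ⟨c, hc, hcn⟩ := normalized_firstSpin_power_law hα hr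
  refine not_forall_rpow_le_geometric (c := c / 2 ^ α) (α := α)
    (A := A * waltersNorm s firstSpin) (by positivity) hτ hτ1 fun n hn => ?_
  have h1 := hA n hn firstSpin (isWalters_comp_firstSpin id) allUp
  rw [integral_firstSpin hr, mul_zero, sub_zero] at h1
  have hn1 : (1 : ℝ) ≤ n := by exact_mod_cast hn
  calc c / 2 ^ α / (n : ℝ) ^ α = c / (2 * (n : ℝ)) ^ α := by
        rw [Real.mul_rpow (by norm_num) (by positivity), div_div]
    _ ≤ c / ((n : ℝ) + 1) ^ α := by
        gcongr
        linarith
    _ ≤ A * τ ^ n * waltersNorm s firstSpin := (hcn n).trans ((le_abs_self _).trans h1)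
    _ = _ := by ring

end Correlation

/-! ### The Walters norm. -/

section Norm

theorem IsWalters.exists_variation_bound {E : Type*} [NormedAddCommGroup E] {φ : Conf → E}
    (hφ : IsWalters φ) : ∃ C : ℝ, ∀ n x y, Agree n x y →
      ‖birkhoffSum shift φ n x - birkhoffSum shift φ n y‖ ≤ C := by
  obtain ⟨B, hB0, hB⟩ := exists_norm_bound hφ.1
  obtain ⟨N, hN⟩ := isWalters_iff_agree.1 hφ 1 one_pos
  have hS : ∀ n, n ≤ N → ∀ x, ‖birkhoffSum shift φ n x‖ ≤ N * B := fun n hn x => by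
    refine (norm_sum_le_of_le _ fun k _ => hB _).trans ?_
    simp only [Finset.sum_const, Finset.card_range, nsmul_eq_mul]
    gcongr
  refine ⟨1 + (N * B + N * B), fun n x y hxy => ?_⟩
  rcases le_total n N with hn | hn
  · linarith [norm_sub_le_of_le (hS n hn x) (hS n hn y)]
  · obtain ⟨m, rfl⟩ := Nat.exists_eq_add_of_le' hn
    rw [birkhoffSum_add, birkhoffSum_add, add_sub_add_comm]
    exact norm_add_le_of_le (hN m x y hxy)
      (norm_sub_le_of_le (hS N le_rfl _) (hS N le_rfl _))

variable {φ ψ : Conf → ℂ} {s : ℝ}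

/-- Needed because `sSup` of an unbounded set of reals is `0`. For `s < 1` closeness in the Bowen
metric forces agreement on the first `n` coordinates. -/
theorem IsWalters.bddAbove_variation (hφ : IsWalters φ) (hs : s < 1) :
    BddAbove {t : ℝ | ∃ n : ℕ, 1 ≤ n ∧ ∃ x y : Conf, bowenDist n x y ≤ s ∧
      t = ‖birkhoffSum shift φ n x - birkhoffSum shift φ n y‖} := by
  obtain ⟨C, hC⟩ := hφ.exists_variation_bound
  refine ⟨C, ?_⟩
  rintro _ ⟨n, hn, x, y, hxy, rfl⟩
  exact hC n x y (agree_of_bowenDist_le (N := 0) hn (by simpa using hs) hxy)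

theorem IsWalters.norm_le_iSup (hφ : IsWalters φ) (x : Conf) : ‖φ x‖ ≤ ⨆ x, ‖φ x‖ := by
  obtain ⟨B, -, hB⟩ := exists_norm_bound hφ.1
  exact le_ciSup (f := fun x => ‖φ x‖) ⟨B, by rintro _ ⟨x, rfl⟩; exact hB x⟩ x

/-- The second term of `waltersNorm s φ`. -/
noncomputable def bowenVariation (s : ℝ) (φ : Conf → ℂ) : ℝ :=
  sSup {t : ℝ | ∃ n : ℕ, 1 ≤ n ∧ ∃ x y : Conf, bowenDist n x y ≤ s ∧
      t = ‖birkhoffSum shift φ n x - birkhoffSum shift φ n y‖}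

theorem bowenVariation_nonneg (s : ℝ) (φ : Conf → ℂ) : 0 ≤ bowenVariation s φ := by
  refine Real.sSup_nonneg ?_
  rintro _ ⟨n, hn, x, y, hxy, rfl⟩
  exact norm_nonneg _

theorem waltersNorm_nonneg (s : ℝ) (φ : Conf → ℂ) : 0 ≤ waltersNorm s φ :=
  add_nonneg (mul_nonneg zero_le_two (Real.iSup_nonneg fun _ => norm_nonneg _))
    (bowenVariation_nonneg s φ)

theorem IsWalters.norm_le_waltersNorm (hφ : IsWalters φ) (s : ℝ) (x : Conf) :
    ‖φ x‖ ≤ waltersNorm s φ := by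
  have h1 := hφ.norm_le_iSup x
  have h2 := bowenVariation_nonneg s φ
  have h3 := norm_nonneg (φ x)
  change _ ≤ 2 * _ + bowenVariation s φ
  linarith

theorem birkhoffSum_add_const_mul (φ ψ : Conf → ℂ) (c : ℂ) (n : ℕ) (x : Conf) :
    birkhoffSum shift (fun x => φ x + c * ψ x) n x =
      birkhoffSum shift φ n x + c * birkhoffSum shift ψ n x := by
  simp only [birkhoffSum, Finset.sum_add_distrib, Finset.mul_sum]

theorem norm_birkhoffSum_add_const_mul_sub_le (φ ψ : Conf → ℂ) (c : ℂ) (n : ℕ) (x y : Conf) :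
    ‖birkhoffSum shift (fun x => φ x + c * ψ x) n x -
        birkhoffSum shift (fun x => φ x + c * ψ x) n y‖ ≤
      ‖birkhoffSum shift φ n x - birkhoffSum shift φ n y‖ +
        ‖c‖ * ‖birkhoffSum shift ψ n x - birkhoffSum shift ψ n y‖ := by
  rw [birkhoffSum_add_const_mul, birkhoffSum_add_const_mul, add_sub_add_comm, ← mul_sub,
    ← norm_mul]
  exact norm_add_le _ _

theorem IsWalters.add_const_mul (hφ : IsWalters φ) (hψ : IsWalters ψ) (c : ℂ) :
    IsWalters fun x => φ x + c * ψ x := by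
  refine isWalters_iff_agree.2 fun ε hε => ?_
  obtain ⟨N, hN⟩ := isWalters_iff_agree.1 hφ (ε / 2) (half_pos hε)
  obtain ⟨M, hM⟩ := isWalters_iff_agree.1 hψ (ε / (2 * (‖c‖ + 1))) (by positivity)
  refine ⟨max N M, fun n x y hxy => ?_⟩
  have h1 := hN n x y (hxy.mono (by omega))
  have h2 := hM n x y (hxy.mono (by omega))
  refine (norm_birkhoffSum_add_const_mul_sub_le φ ψ c n x y).trans ?_
  have h3 : ‖c‖ * ‖birkhoffSum shift ψ n x - birkhoffSum shift ψ n y‖ ≤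
      (‖c‖ + 1) * (ε / (2 * (‖c‖ + 1))) := by
    gcongr
    linarith
  have h4 : (‖c‖ + 1) * (ε / (2 * (‖c‖ + 1))) = ε / 2 := by field_simp
  linarith

theorem isWalters_zero : IsWalters fun _ : Conf => (0 : ℂ) :=
  isWalters_comp_firstSpin fun _ => 0

theorem IsWalters.const_mul (hψ : IsWalters ψ) (c : ℂ) : IsWalters fun x => c * ψ x := by
  simpa using isWalters_zero.add_const_mul hψ c

theorem waltersNorm_add_const_mul_le (hφ : IsWalters φ) (hψ : IsWalters ψ) (hs : s < 1) (c : ℂ) :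
    waltersNorm s (fun x => φ x + c * ψ x) ≤ waltersNorm s φ + ‖c‖ * waltersNorm s ψ := by
  have h1 : (⨆ x, ‖φ x + c * ψ x‖) ≤ (⨆ x, ‖φ x‖) + ‖c‖ * ⨆ x, ‖ψ x‖ := by
    have : Nonempty Conf := ⟨allUp⟩
    refine ciSup_le fun x => (norm_add_le _ _).trans (add_le_add (hφ.norm_le_iSup x) ?_)
    rw [norm_mul]
    exact mul_le_mul_of_nonneg_left (hψ.norm_le_iSup x) (norm_nonneg c)
  have h2 : bowenVariation s (fun x => φ x + c * ψ x) ≤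
      bowenVariation s φ + ‖c‖ * bowenVariation s ψ := by
    refine Real.sSup_le ?_ (add_nonneg (bowenVariation_nonneg s φ)
      (mul_nonneg (norm_nonneg c) (bowenVariation_nonneg s ψ)))
    rintro _ ⟨n, hn, x, y, hxy, rfl⟩
    refine (norm_birkhoffSum_add_const_mul_sub_le φ ψ c n x y).trans (add_le_add ?_
      (mul_le_mul_of_nonneg_left ?_ (norm_nonneg c)))
    · exact le_csSup (hφ.bddAbove_variation hs) ⟨n, hn, x, y, hxy, rfl⟩
    · exact le_csSup (hψ.bddAbove_variation hs) ⟨n, hn, x, y, hxy, rfl⟩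
  change 2 * _ + bowenVariation s _ ≤ 2 * _ + bowenVariation s φ +
    ‖c‖ * (2 * _ + bowenVariation s ψ)
  linarith

theorem waltersNorm_const_mul_le (hψ : IsWalters ψ) (hs : s < 1) (c : ℂ) :
    waltersNorm s (fun x => c * ψ x) ≤ ‖c‖ * waltersNorm s ψ := by
  have h := waltersNorm_add_const_mul_le isWalters_zero hψ hs c
  have h0 : waltersNorm s (fun _ : Conf => (0 : ℂ)) = 0 := by
    refine le_antisymm ?_ (waltersNorm_nonneg _ _)
    have h1 : bowenVariation s (fun _ => 0) ≤ 0 := by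
      refine Real.sSup_le ?_ le_rfl
      rintro _ ⟨n, hn, x, y, hxy, rfl⟩
      simp [birkhoffSum]
    change 2 * _ + bowenVariation s _ ≤ 0
    simpa using h1
  simpa [h0] using h

theorem shift_iterate_flip (n : ℕ) (x : Conf) : shift^[n] (flip x) = flip (shift^[n] x) := by
  ext1 i
  simp only [shift_iterate_apply, flip]

theorem IsWalters.comp_flip (hφ : IsWalters φ) : IsWalters fun x => φ (flip x) := by
  refine isWalters_iff_agree.2 fun ε hε => ?_
  obtain ⟨N, hN⟩ := isWalters_iff_agree.1 hφ ε hε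
  refine ⟨N, fun n x y hxy => ?_⟩
  have h : ∀ x, birkhoffSum shift (fun x => φ (flip x)) n x = birkhoffSum shift φ n (flip x) :=
    fun x => by simp only [birkhoffSum, shift_iterate_flip]
  rw [h, h]
  exact hN n _ _ fun i hi => congrArg flipSpin (hxy i hi)

end Norm

/-! ### Resolvent estimates. -/

section Resolvent

variable {f : Conf → ℝ} {s : ℝ}

theorem ruelle_add_const_mul (f : Conf → ℝ) (φ ψ : Conf → ℂ) (c : ℂ) (x : Conf) :
    ruelle f (fun x => φ x + c * ψ x) x = ruelle f φ x + c * ruelle f ψ x := by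
  simp only [ruelle_apply, Complex.real_smul]
  ring

theorem ruelle_re (f : Conf → ℝ) (φ : Conf → ℂ) (x : Conf) :
    ruelle f (fun x => (φ x).re) x = (ruelle f φ x).re := by
  simp only [ruelle_apply, Complex.add_re, Complex.smul_re]

theorem ruelle_im (f : Conf → ℝ) (φ : Conf → ℂ) (x : Conf) :
    ruelle f (fun x => (φ x).im) x = (ruelle f φ x).im := by
  simp only [ruelle_apply, Complex.add_im, Complex.smul_im]

theorem IsResolventSolution.change_point {z : ℂ} {ψ φ : Conf → ℂ}
    (h : IsResolventSolution f z ψ φ) (w : ℂ) :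
    IsResolventSolution f w (fun x => ψ x + (w - z) * φ x) φ :=
  ⟨h.1, fun x => by linear_combination h.2 x⟩

/-- A solution at `z` solves the equation at `w` with the extra source `(w - z) φ`. For `z` near `w`
this term is absorbed on the left. -/
theorem exists_resolvent_bound (hs : s < 1) {w : ℂ} (hw : w ∈ waltersResolventSet f s) :
    ∃ K : ℝ, 0 < K ∧ (∀ (ψ φ : Conf → ℂ), IsWalters ψ → IsResolventSolution f w ψ φ →
        waltersNorm s φ ≤ K * waltersNorm s ψ) ∧
      ∀ (z : ℂ) (ψ φ : Conf → ℂ), IsWalters ψ → IsResolventSolution f z ψ φ →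
        ‖w - z‖ < 1 / (2 * K) → waltersNorm s φ ≤ 2 * K * waltersNorm s ψ := by
  obtain ⟨K, hK⟩ := hw.2
  have hK' : ∀ (ψ φ : Conf → ℂ), IsWalters ψ → IsResolventSolution f w ψ φ →
      waltersNorm s φ ≤ max K 1 * waltersNorm s ψ := fun ψ φ hψ hφ =>
    (hK ψ φ hψ hφ).trans (mul_le_mul_of_nonneg_right (le_max_left _ _) (waltersNorm_nonneg _ _))
  have hK0 : 0 < max K 1 := by positivity
  refine ⟨max K 1, hK0, hK', fun z ψ φ hψ hφ hz => ?_⟩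
  have h1 := hK' _ φ (hψ.add_const_mul hφ.1 (w - z)) (hφ.change_point w)
  have h2 := mul_le_mul_of_nonneg_left (waltersNorm_add_const_mul_le hψ hφ.1 hs (w - z)) hK0.le
  have h3 := waltersNorm_nonneg s φ
  rw [lt_div_iff₀ (by positivity)] at hz
  nlinarith

/-- Solutions of the resolvent equation are bounded on compact subsets of the resolvent set. -/
theorem exists_resolvent_bound_of_isCompact (hs : s < 1) {S : Set ℂ} (hS : IsCompact S)
    (hSr : S ⊆ waltersResolventSet f s) {ψ : Conf → ℂ} (hψ : IsWalters ψ) {R : ℂ → Conf → ℂ}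
    (hR : ∀ z ∈ S, IsResolventSolution f z ψ (R z)) :
    ∃ M : ℝ, ∀ z ∈ S, waltersNorm s (R z) ≤ M := by
  refine hS.induction_on (p := fun T => ∃ M : ℝ, ∀ z ∈ T, z ∈ S → waltersNorm s (R z) ≤ M)
    ⟨0, by simp⟩ ?_ ?_ ?_ |>.imp fun M hM z hz => hM z hz hz
  · rintro T T' hTT ⟨M, hM⟩
    exact ⟨M, fun z hz => hM z (hTT hz)⟩
  · rintro T T' ⟨M, hM⟩ ⟨M', hM'⟩
    refine ⟨max M M', ?_⟩
    rintro z (hz | hz) hzS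
    · exact (hM z hz hzS).trans (le_max_left _ _)
    · exact (hM' z hz hzS).trans (le_max_right _ _)
  · intro w hw
    obtain ⟨K, hK, -, hb⟩ := exists_resolvent_bound hs (hSr hw)
    refine ⟨Metric.ball w (1 / (2 * K)),
      mem_nhdsWithin_of_mem_nhds (Metric.ball_mem_nhds _ (by positivity)),
      2 * K * waltersNorm s ψ, fun z hz hzS => hb z ψ (R z) hψ (hR z hzS) ?_⟩
    rwa [Metric.mem_ball', dist_eq_norm] at hz

theorem continuousOn_resolvent (hs : s < 1) {S : Set ℂ} (hS : IsCompact S)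
    (hSr : S ⊆ waltersResolventSet f s) {ψ : Conf → ℂ} (hψ : IsWalters ψ) {R : ℂ → Conf → ℂ}
    (hR : ∀ z ∈ S, IsResolventSolution f z ψ (R z)) (x : Conf) :
    ContinuousOn (fun z => R z x) S := by
  obtain ⟨M, hM⟩ := exists_resolvent_bound_of_isCompact hs hS hSr hψ hR
  intro w hw
  obtain ⟨K, hK, hb, -⟩ := exists_resolvent_bound hs (hSr hw)
  have key : ∀ z ∈ S, ‖R z x - R w x‖ ≤ K * (‖w - z‖ * M) := by
    intro z hz
    -- The resolvent identity, which never applies the operator outside its domain.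
    have hsol : IsResolventSolution f w (fun x => (w - z) * R z x)
        (fun x => R z x + (-1) * R w x) := by
      refine ⟨(hR z hz).1.add_const_mul (hR w hw).1 _, fun x => ?_⟩
      rw [ruelle_add_const_mul]
      linear_combination (hR z hz).2 x - (hR w hw).2 x
    have h1 := hsol.1.norm_le_waltersNorm s x
    have h2 := hb _ _ ((hR z hz).1.const_mul (w - z)) hsol
    have h3 := waltersNorm_const_mul_le (hR z hz).1 hs (w - z)
    have h4 := mul_le_mul_of_nonneg_left (hM z hz) (norm_nonneg (w - z))
    have h5 : R z x + (-1) * R w x = R z x - R w x := by ring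
    rw [h5] at h1
    exact h1.trans (h2.trans (mul_le_mul_of_nonneg_left (h3.trans h4) hK.le))
  refine tendsto_iff_norm_sub_tendsto_zero.2 ?_
  refine squeeze_zero' (Eventually.of_forall fun _ => norm_nonneg _)
    (eventually_nhdsWithin_of_forall key) ?_
  have : Continuous fun z : ℂ => K * (‖w - z‖ * M) := by fun_prop
  have h0 := (this.tendsto w).mono_left (nhdsWithin_le_nhds (s := S))
  simpa using h0

end Resolvent

/-! ### Repeated summation of power laws. -/

section PowerLaw

theorem not_bounded_of_increments {u : ℕ → ℝ} {B δ : ℝ} (hδ : 0 < δ) {j₀ : ℕ}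
    (hB : ∀ j, |u j| ≤ B) (h : ∀ j, j₀ ≤ j → u j + δ ≤ u (j + 1)) : False := by
  have h1 : ∀ i : ℕ, u j₀ + i * δ ≤ u (j₀ + i) := by
    intro i
    induction i with
    | zero => simp
    | succ i ih =>
      have := h (j₀ + i) (Nat.le_add_right _ _)
      rw [← add_assoc]
      push_cast
      linarith
  obtain ⟨i, hi⟩ := exists_nat_gt (2 * B / δ)
  rw [div_lt_iff₀ hδ] at hi
  have h2 := (abs_le.1 (hB j₀)).1
  have h3 := (abs_le.1 (hB (j₀ + i))).2
  linarith [h1 i]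

/-- Summing a power law sequence repeatedly cannot produce bounded sequences forever. -/
theorem power_law_chain_absurd {b : ℕ → ℕ → ℝ} {lam α c : ℝ} (hlam : 0 < lam) (hc : 0 < c)
    (hbdd : ∀ m, ∃ B, ∀ j, |b m j| ≤ B)
    (hrec : ∀ m j, lam * (b (m + 1) j - b (m + 1) (j + 1)) = b m j)
    (h0 : ∀ j : ℕ, c * ((j : ℝ) + 1) ^ (-α) ≤ b 0 j) : False := by
  have claim : ∀ m : ℕ, ∃ c : ℝ, 0 < c ∧ ∀ j : ℕ, c * ((j : ℝ) + 1) ^ ((m : ℝ) - α) ≤ b m j := by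
    intro m
    induction m with
    | zero => exact ⟨c, hc, by simpa using h0⟩
    | succ m ih =>
      obtain ⟨c, hc, hm⟩ := ih
      set p : ℝ := (m : ℝ) - α
      have hpos : ∀ j, 0 < b m j := fun j => lt_of_lt_of_le (by positivity) (hm j)
      have hdec : ∀ j, b (m + 1) (j + 1) = b (m + 1) j - b m j / lam := fun j => by
        rw [← hrec m j]; field_simp; ring
      have hanti : Antitone (b (m + 1)) := antitone_nat_of_succ_le fun j => by
        rw [hdec]; linarith [div_pos (hpos j) hlam]
      -- A negative value of this decreasing sequence would persist, and the next sequence in the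
      -- chain would grow at least linearly.
      have hnonneg : ∀ j, 0 ≤ b (m + 1) j := by
        intro j
        by_contra! hneg
        obtain ⟨B, hB⟩ := hbdd (m + 2)
        refine not_bounded_of_increments (u := b (m + 2)) (δ := -(b (m + 1) j) / lam)
          (j₀ := j) (div_pos (by linarith) hlam) hB fun i hi => ?_
        have h1 := hanti hi
        have h2 : b (m + 2) (i + 1) = b (m + 2) i - b (m + 1) i / lam := by
          rw [← hrec (m + 1) i]; field_simp; ring
        rw [h2, neg_div]
        linarith [div_le_div_of_nonneg_right h1 hlam.le]
      have htel : ∀ j k, b (m + 1) j = b (m + 1) (j + k) +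
          (∑ i ∈ Finset.range k, b m (j + i)) / lam := by
        intro j k
        induction k with
        | zero => simp
        | succ k ih => rw [ih, Finset.sum_range_succ, ← add_assoc, hdec, add_div]; ring
      have hq : (0 : ℝ) < min 1 (2 ^ p) := by positivity
      refine ⟨c * min 1 (2 ^ p) / lam, by positivity, fun j => ?_⟩
      -- The `j + 1` terms from `j` to `2 * j` are all comparable to the power at `j`, so their sum
      -- gains one power. The minimum covers both signs of the exponent `p`.
      have hterm : ∀ i ∈ Finset.range (j + 1),
          c * (min 1 (2 ^ p) * ((j : ℝ) + 1) ^ p) ≤ b m (j + i) := by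
        intro i hi
        have hi' : i ≤ j := Nat.lt_succ_iff.1 (Finset.mem_range.1 hi)
        have hir : (i : ℝ) ≤ j := by exact_mod_cast hi'
        have hi0 : (0 : ℝ) ≤ i := Nat.cast_nonneg i
        have hj0 : (0 : ℝ) < (j : ℝ) + 1 := by positivity
        refine le_trans (mul_le_mul_of_nonneg_left ?_ hc.le) (hm (j + i))
        push_cast
        rcases le_total 0 p with hp | hp
        · calc min 1 (2 ^ p) * ((j : ℝ) + 1) ^ p ≤ 1 * ((j : ℝ) + 1) ^ p := by
                gcongr; exact min_le_left _ _
            _ ≤ _ := by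
                rw [one_mul]
                exact Real.rpow_le_rpow hj0.le (by linarith) hp
        · calc min 1 (2 ^ p) * ((j : ℝ) + 1) ^ p ≤ 2 ^ p * ((j : ℝ) + 1) ^ p := by
                gcongr; exact min_le_right _ _
            _ = (2 * ((j : ℝ) + 1)) ^ p := (Real.mul_rpow (by norm_num) hj0.le).symm
            _ ≤ _ := Real.rpow_le_rpow_of_nonpos (by positivity) (by linarith) hp
      have hsum := Finset.card_nsmul_le_sum _ _ _ hterm
      rw [Finset.card_range, nsmul_eq_mul] at hsum
      rw [htel j (j + 1)]
      have hexp : ((j : ℝ) + 1) ^ (((m + 1 : ℕ) : ℝ) - α) = ((j : ℝ) + 1) ^ p * ((j : ℝ) + 1) := by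
        rw [← Real.rpow_add_one (by positivity)]
        congr 1
        push_cast
        ring
      have h1 := div_le_div_of_nonneg_right hsum hlam.le
      have h2 := hnonneg (j + (j + 1))
      refine le_trans (le_of_eq ?_) (h1.trans (by linarith))
      rw [hexp]
      push_cast
      ring
  obtain ⟨m, hm⟩ := exists_nat_gt (α + 1)
  obtain ⟨c, hc, h⟩ := claim m
  obtain ⟨B, hB⟩ := hbdd m
  obtain ⟨j, hj⟩ := exists_nat_gt (B / c)
  rw [div_lt_iff₀ hc] at hj
  have h1 : (j : ℝ) + 1 ≤ ((j : ℝ) + 1) ^ ((m : ℝ) - α) :=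
    Real.self_le_rpow_of_one_le (by linarith [(Nat.cast_nonneg j : (0 : ℝ) ≤ j)]) (by linarith)
  have h2 := mul_le_mul_of_nonneg_left h1 hc.le
  linarith [h j, (abs_le.1 (hB j)).2]

/-- `firstSpin` is not in the range of all powers of `lam - L_f` on bounded functions. -/
theorem firstSpin_chain_absurd {α lam : ℝ} {h : Conf → ℝ} {ν : Measure Conf} (hα : 2 < α)
    (hr : IsRuelleTriple (isingPotential α) lam h ν) {g : ℕ → Conf → ℝ}
    (hg0 : g 0 = firstSpin) (hbdd : ∀ m, ∃ B, ∀ x, |g m x| ≤ B)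
    (hrec : ∀ m x, lam * g (m + 1) x - ruelle (isingPotential α) (g (m + 1)) x = g m x) :
    False := by
  obtain ⟨_, C, -, hC, hCb⟩ := hr.exists_partitionFun_bounds
  obtain ⟨c, hc, hcb⟩ := normalized_firstSpin_power_law hα hr
  set f := isingPotential α
  refine power_law_chain_absurd (α := α) hr.lam_pos hc
    (b := fun m j => (lam ^ j)⁻¹ * (ruelle f)^[j] (g m) allUp) (fun m => ?_) (fun m j => ?_)
    fun j => ?_
  · obtain ⟨B, hB⟩ := hbdd m
    refine ⟨B * C, fun j => ?_⟩
    have hB0 : 0 ≤ B := (abs_nonneg _).trans (hB allUp)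
    have hl : 0 < (lam ^ j)⁻¹ := inv_pos.2 (pow_pos hr.lam_pos j)
    have h1 := mul_le_mul_of_nonneg_left (ruelle_iterate_mono f j (φ := g m)
      (ψ := fun _ => B * 1) (fun x => by simpa using (abs_le.1 (hB x)).2) allUp) hl.le
    have h2 := mul_le_mul_of_nonneg_left (ruelle_iterate_mono f j (φ := fun _ => (-B) * 1)
      (ψ := g m) (fun x => by simpa using (abs_le.1 (hB x)).1) allUp) hl.le
    rw [ruelle_iterate_const_mul f j _ fun _ => 1] at h1 h2
    have h3 := mul_le_mul_of_nonneg_left (hCb j allUp).2 hB0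
    exact abs_le.2 ⟨by linarith, by linarith⟩
  · have h1 : g m = fun x => lam * g (m + 1) x - ruelle f (g (m + 1)) x :=
      funext fun x => (hrec m x).symm
    have h2 : (ruelle f)^[j] (g m) allUp = lam * (ruelle f)^[j] (g (m + 1)) allUp -
        (ruelle f)^[j + 1] (g (m + 1)) allUp := by
      rw [h1, ruelle_iterate_sub, Function.iterate_succ_apply]
      simp only [ruelle_iterate_const_mul]
    have hl := hr.lam_pos.ne'
    simp only [h2]
    field_simp
    ring
  · simp only [hg0]
    rw [Real.rpow_neg (by positivity), ← div_eq_mul_inv]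
    exact hcb j

end PowerLaw

/-! ### Contour moments of the resolvent. -/

section Contour

/-- The Laurent coefficients `∮ R z x / (lam - z) ^ m` of a family of resolvent solutions. -/
noncomputable def laurentCoeff (R : ℂ → Conf → ℂ) (lam : ℂ) (δ : ℝ) (m : ℕ) (x : Conf) : ℂ :=
  ∮ z in C(lam, δ), ((lam - z) ^ m)⁻¹ * R z x

theorem sub_ne_zero_of_mem_sphere {lam z : ℂ} {δ : ℝ} (hδ : 0 < δ)
    (hz : z ∈ Metric.sphere lam δ) : lam - z ≠ 0 := by
  rintro h
  rw [sub_eq_zero] at h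
  subst h
  rw [Metric.mem_sphere, dist_self] at hz
  exact hδ.ne hz

theorem norm_sub_of_mem_sphere {lam z : ℂ} {δ : ℝ} (hz : z ∈ Metric.sphere lam δ) :
    ‖lam - z‖ = δ := by
  rwa [← dist_eq_norm, ← Metric.mem_sphere']

theorem continuousOn_inv_sub_pow {lam : ℂ} {δ : ℝ} (hδ : 0 < δ) (m : ℕ) :
    ContinuousOn (fun z => ((lam - z) ^ m)⁻¹) (Metric.sphere lam δ) :=
  ContinuousOn.inv₀ (by fun_prop) fun _ hz => pow_ne_zero m (sub_ne_zero_of_mem_sphere hδ hz)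

theorem circleIntegral_inv_sub_pow {lam : ℂ} {δ : ℝ} (hδ : 0 < δ) (m : ℕ) :
    (∮ z in C(lam, δ), ((lam - z) ^ (m + 1))⁻¹) =
      if m = 0 then -(2 * (Real.pi : ℂ) * Complex.I) else 0 := by
  have h : ∀ z : ℂ, ((lam - z) ^ (m + 1))⁻¹ =
      (-1) ^ (m + 1) * (z - lam) ^ (-((m + 1 : ℕ) : ℤ)) := fun z => by
    rw [zpow_neg, zpow_natCast, ← neg_sub z lam, neg_pow, mul_inv]
    congr 1
    rw [← inv_pow]
    norm_num
  simp only [h]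
  rw [circleIntegral.integral_const_mul]
  split_ifs with hm
  · subst hm
    simp [circleIntegral.integral_sub_center_inv lam hδ.ne']
  · rw [circleIntegral.integral_sub_zpow_of_ne (by omega), mul_zero]

variable {f : Conf → ℝ} {lam : ℂ} {δ : ℝ} {ψ : Conf → ℂ} {R : ℂ → Conf → ℂ}

/-- Under the integral, `lam - L` is `(lam - z) + (z - L)`: the first summand lowers the exponent,
the second produces `ψ` times a scalar contour integral that vanishes unless `m = 0`. The operator
is a finite weighted sum of point values, so pointwise integrability suffices. -/
theorem laurentCoeff_rec (hδ : 0 < δ)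
    (hR : ∀ z ∈ Metric.sphere lam δ, IsResolventSolution f z ψ (R z))
    (hc : ∀ x, ContinuousOn (fun z => R z x) (Metric.sphere lam δ)) (m : ℕ) (x : Conf) :
    lam * laurentCoeff R lam δ (m + 1) x - ruelle f (laurentCoeff R lam δ (m + 1)) x =
      laurentCoeff R lam δ m x +
        ψ x * if m = 0 then -(2 * (Real.pi : ℂ) * Complex.I) else 0 := by
  have hi : ∀ k y, CircleIntegrable (fun z => ((lam - z) ^ k)⁻¹ * R z y) lam δ := fun k y =>
    ((continuousOn_inv_sub_pow hδ k).mul (hc y)).circleIntegrable hδ.le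
  have hir : ∀ (c : ℂ) y, CircleIntegrable (fun z => c * (((lam - z) ^ (m + 1))⁻¹ * R z y)) lam δ :=
    fun c y => (continuousOn_const.mul
      ((continuousOn_inv_sub_pow hδ (m + 1)).mul (hc y))).circleIntegrable hδ.le
  have hψ : CircleIntegrable (fun z => ψ x * ((lam - z) ^ (m + 1))⁻¹) lam δ :=
    (continuousOn_const.mul (continuousOn_inv_sub_pow hδ (m + 1))).circleIntegrable hδ.le
  have hsum : CircleIntegrable (fun z => ((1 / 2 * Real.exp (f (prepend spinDown x)) : ℝ) : ℂ) *
          (((lam - z) ^ (m + 1))⁻¹ * R z (prepend spinDown x)) +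
        ((1 / 2 * Real.exp (f (prepend spinUp x)) : ℝ) : ℂ) *
          (((lam - z) ^ (m + 1))⁻¹ * R z (prepend spinUp x))) lam δ := (hir _ _).add (hir _ _)
  have h1 : ruelle f (laurentCoeff R lam δ (m + 1)) x =
      ∮ z in C(lam, δ), ((1 / 2 * Real.exp (f (prepend spinDown x)) : ℝ) : ℂ) *
          (((lam - z) ^ (m + 1))⁻¹ * R z (prepend spinDown x)) +
        ((1 / 2 * Real.exp (f (prepend spinUp x)) : ℝ) : ℂ) *
          (((lam - z) ^ (m + 1))⁻¹ * R z (prepend spinUp x)) := by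
    rw [circleIntegral.integral_add (hir _ _) (hir _ _), circleIntegral.integral_const_mul,
      circleIntegral.integral_const_mul, ruelle_apply]
    simp only [laurentCoeff, Complex.real_smul, Complex.ofReal_mul]
    ring
  rw [← circleIntegral_inv_sub_pow (lam := lam) hδ m, h1, ← circleIntegral.integral_const_mul]
  unfold laurentCoeff
  rw [← circleIntegral.integral_const_mul, ← circleIntegral.integral_sub (hir _ _) hsum,
    ← circleIntegral.integral_add (hi m x) hψ]
  refine circleIntegral.integral_congr hδ.le fun z hz => ?_
  have h0 := sub_ne_zero_of_mem_sphere hδ hz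
  have h2 := (hR z hz).2 x
  rw [ruelle_apply] at h2
  simp only [Complex.real_smul] at h2
  have h3 : ((lam - z) ^ m)⁻¹ = (lam - z) * ((lam - z) ^ (m + 1))⁻¹ := by
    rw [pow_succ]
    field_simp
  simp only [h3, ← h2, Complex.ofReal_mul]
  ring

theorem norm_laurentCoeff_le (hδ : 0 < δ) {M : ℝ}
    (hM : ∀ z ∈ Metric.sphere lam δ, ∀ x, ‖R z x‖ ≤ M) (m : ℕ) (x : Conf) :
    ‖laurentCoeff R lam δ m x‖ ≤ 2 * Real.pi * δ * ((δ ^ m)⁻¹ * M) := by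
  refine circleIntegral.norm_integral_le_of_norm_le_const hδ.le fun z hz => ?_
  rw [norm_mul, norm_inv, norm_pow, norm_sub_of_mem_sphere hz]
  exact mul_le_mul_of_nonneg_left (hM z hz x) (by positivity)

end Contour

/-! ### Absence of a spectral gap. -/

section SpectralGap

variable {f : Conf → ℝ} {lam : ℝ} {h : Conf → ℝ} {ν : Measure Conf}

/-- Every function in the range of `lam - L` has `ν`-integral zero, so the constant `1` is not
attained. -/
theorem IsRuelleTriple.mem_waltersSpectrum (hr : IsRuelleTriple f lam h ν) (hf : Continuous f)
    (s : ℝ) : (lam : ℂ) ∈ waltersSpectrum f s := by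
  rintro ⟨hbij, -⟩
  obtain ⟨φ, ⟨hφ, he⟩, -⟩ := hbij (fun _ => 1) (isWalters_comp_firstSpin fun _ => 1)
  have := hr.isProbabilityMeasure
  have hc : Continuous fun x => (φ x).re := Complex.continuous_re.comp hφ.1
  have h1 : ∀ x, lam * (φ x).re - ruelle f (fun x => (φ x).re) x = 1 := fun x => by
    rw [ruelle_re, ← Complex.re_ofReal_mul, ← Complex.sub_re, he x, Complex.one_re]
  have h2 : ∫ x, (lam * (φ x).re - ruelle f (fun x => (φ x).re) x) ∂ν = 1 := by
    simp only [h1, integral_const, probReal_univ, one_smul]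
  rw [integral_sub ((hc.integrable_conf ν).const_mul lam)
    ((continuous_ruelle hf hc).integrable_conf ν), integral_const_mul, hr.eigenmeasure _ hc,
    sub_self] at h2
  exact zero_ne_one h2

/-- Maximum principle for $|\varphi|/h$, evaluated at a point where the maximum is attained. -/
theorem IsRuelleTriple.norm_eigenvalue_le (hr : IsRuelleTriple f lam h ν) {w : ℂ}
    {φ : Conf → ℂ} (hφ : Continuous φ) (h0 : φ ≠ 0) (he : ∀ x, ruelle f φ x = w * φ x) :
    ‖w‖ ≤ lam := by
  have hc : Continuous fun x => ‖φ x‖ / h x :=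
    hφ.norm.div hr.continuous fun x => (hr.pos x).ne'
  obtain ⟨p, -, hp⟩ := isCompact_univ.exists_isMaxOn ⟨allUp, Set.mem_univ _⟩ hc.continuousOn
  set M := ‖φ p‖ / h p with hMdef
  have hM : ∀ x, ‖φ x‖ ≤ M * h x := fun x => (div_le_iff₀ (hr.pos x)).1 (hp (Set.mem_univ x))
  have hp0 : 0 < ‖φ p‖ := by
    obtain ⟨q, hq⟩ := Function.ne_iff.1 h0
    have hM0 : 0 < M := pos_of_mul_pos_left
      ((norm_pos_iff.2 hq).trans_le (hM q)) (hr.pos q).le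
    exact (div_pos_iff_of_pos_right (hr.pos p)).1 hM0
  have h1 : ‖w‖ * ‖φ p‖ ≤ M * ruelle f h p := by
    rw [← norm_mul, ← he, ruelle_apply, ruelle_apply, norm_smul, smul_eq_mul]
    have h2 := norm_add_le (Real.exp (f (prepend spinDown p)) • φ (prepend spinDown p))
      (Real.exp (f (prepend spinUp p)) • φ (prepend spinUp p))
    rw [norm_smul, norm_smul, Real.norm_of_nonneg (Real.exp_pos _).le,
      Real.norm_of_nonneg (Real.exp_pos _).le] at h2
    have h3 := mul_le_mul_of_nonneg_left (hM (prepend spinDown p))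
      (Real.exp_pos (f (prepend spinDown p))).le
    have h4 := mul_le_mul_of_nonneg_left (hM (prepend spinUp p))
      (Real.exp_pos (f (prepend spinUp p))).le
    rw [Real.norm_of_nonneg (by norm_num : (0 : ℝ) ≤ 1 / 2)]
    simp only [smul_eq_mul]
    linarith
  rw [hr.eigenfunction] at h1
  have h2 : M * (lam * h p) = lam * ‖φ p‖ := by
    rw [hMdef]
    field_simp [(hr.pos p).ne']
  exact le_of_mul_le_mul_right (h1.trans_eq h2) hp0

theorem IsRuelleTriple.complex_eigenfunction_flip (hr : IsRuelleTriple f lam h ν)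
    (hf : ∀ x, f (flip x) = f x) {φ : Conf → ℂ} (hφ : Continuous φ)
    (he : ∀ x, ruelle f φ x = lam * φ x) (x : Conf) : φ (flip x) = φ x := by
  have hre := hr.eq_mul_integral (Complex.continuous_re.comp hφ) fun x => by
    change ruelle f (fun x => (φ x).re) x = lam * (φ x).re
    rw [ruelle_re, he, Complex.re_ofReal_mul]
  have him := hr.eq_mul_integral (Complex.continuous_im.comp hφ) fun x => by
    change ruelle f (fun x => (φ x).im) x = lam * (φ x).im
    rw [ruelle_im, he, Complex.im_ofReal_mul]
  apply Complex.ext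
  · have h1 := hre (flip x)
    rw [hr.eigenfunction_flip hf, ← hre x] at h1
    exact h1
  · have h1 := him (flip x)
    rw [hr.eigenfunction_flip hf, ← him x] at h1
    exact h1

theorem isResolventSolution_odd (hf : ∀ x, f (flip x) = f x) {z : ℂ} {ψ φ : Conf → ℂ}
    (hψ : ∀ x, ψ (flip x) = -ψ x) (h : IsResolventSolution f z ψ φ) :
    IsResolventSolution f z ψ fun x => (-1) * φ (flip x) := by
  refine ⟨h.1.comp_flip.const_mul _, fun x => ?_⟩
  have h1 := ruelle_add_const_mul f (fun _ => 0) (fun x => φ (flip x)) (-1) x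
  have h2 : ruelle f (fun _ => (0 : ℂ)) x = 0 := by simp [ruelle_apply]
  simp only [zero_add, h2] at h1
  rw [h1, ruelle_comp_flip hf]
  linear_combination -h.2 (flip x) - hψ x

theorem not_hasSpectralGap_isingPotential {α : ℝ} (hα : 2 < α) {s : ℝ} (hs : s < 1) :
    ¬ HasSpectralGap (isingPotential α) s := by
  obtain ⟨lam, h, ν, hr⟩ := exists_isRuelleTriple_isingPotential hα
  have hflip := isingPotential_flip α
  have hfc := (isWalters_isingPotential hα).1
  rintro ⟨w, ⟨φ, hφ, hφ0, he, δ, hδ, hball, hproj⟩, r, hrw, hspec⟩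
  have hwlam := hr.norm_eigenvalue_le hφ.1 hφ0 he
  -- Otherwise `lam` would be a spectral value in the smaller disc, although no eigenvalue exceeds
  -- it in modulus.
  obtain rfl : (lam : ℂ) = w := by
    by_contra hne
    have := hspec lam (hr.mem_waltersSpectrum hfc s) hne
    rw [Complex.norm_of_nonneg hr.lam_pos.le] at this
    linarith
  have hsph : Metric.sphere (lam : ℂ) δ ⊆ waltersResolventSet (isingPotential α) s := by
    intro z hz
    by_contra hzs
    have hz' : z ∈ Metric.closedBall (lam : ℂ) δ ∩ waltersSpectrum (isingPotential α) s :=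
      ⟨Metric.sphere_subset_closedBall hz, hzs⟩
    rw [hball, Set.mem_singleton_iff] at hz'
    exact sub_ne_zero_of_mem_sphere hδ hz (by rw [hz', sub_self])
  set ψ : Conf → ℂ := fun x => (firstSpin x : ℂ) with hψdef
  have hψ : IsWalters ψ := isWalters_comp_firstSpin fun t => (t : ℂ)
  have hψodd : ∀ x, ψ (flip x) = -ψ x := fun x => by simp [hψdef, firstSpin]
  have hex : ∀ z, ∃ φ, z ∈ Metric.sphere (lam : ℂ) δ →
      IsResolventSolution (isingPotential α) z ψ φ := fun z => by
    by_cases hz : z ∈ Metric.sphere (lam : ℂ) δ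
    · obtain ⟨φ, h1, -⟩ := (hsph hz).1 ψ hψ
      exact ⟨φ, fun _ => h1⟩
    · exact ⟨0, fun h => absurd h hz⟩
  choose R hR using hex
  have hcont := continuousOn_resolvent hs (isCompact_sphere _ _) hsph hψ hR
  obtain ⟨M, hM⟩ := exists_resolvent_bound_of_isCompact hs (isCompact_sphere _ _) hsph hψ hR
  have hM' : ∀ z ∈ Metric.sphere (lam : ℂ) δ, ∀ x, ‖R z x‖ ≤ M := fun z hz x =>
    ((hR z hz).1.norm_le_waltersNorm s x).trans (hM z hz)
  -- The negative of the flipped solution solves the same equation, so uniqueness applies.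
  have hRodd : ∀ z ∈ Metric.sphere (lam : ℂ) δ, ∀ x, R z (flip x) = -R z x := fun z hz x => by
    have := congrFun (((hsph hz).1 ψ hψ).unique (hR z hz)
      (isResolventSolution_odd hflip hψodd (hR z hz))) x
    rw [this]
    ring
  have hpi : (2 * (Real.pi : ℂ) * Complex.I) ≠ 0 := Complex.two_pi_I_ne_zero
  -- The projection of `ψ` is odd, and by simplicity it is also a multiple of an even eigenfunction.
  have hzero : ∀ x, laurentCoeff R lam δ 0 x = 0 := by
    intro x
    obtain ⟨c, hc⟩ := hproj ψ R hψ hR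
    have h1 := hc x
    have h2 := hc (flip x)
    have h3 : (∮ z in C((lam : ℂ), δ), R z (flip x)) = -∮ z in C((lam : ℂ), δ), R z x := by
      rw [← neg_one_mul, ← circleIntegral.integral_const_mul]
      exact circleIntegral.integral_congr hδ.le fun z hz => by simpa using hRodd z hz x
    rw [hr.complex_eigenfunction_flip hflip hφ.1 he, h3, ← h1, mul_neg, neg_eq_iff_add_eq_zero,
      ← two_mul, mul_eq_zero, mul_eq_zero] at h2
    simpa [laurentCoeff, hpi] using h2
  -- The factor $-(2\pi i)^{-1}$ cancels the contour integral at `m = 0`. Real parts are harmless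
  -- because `lam` and the weights are real.
  refine firstSpin_chain_absurd hα hr (g := fun m => match m with
    | 0 => firstSpin
    | m + 1 => fun x => (-(2 * (Real.pi : ℂ) * Complex.I)⁻¹ *
        laurentCoeff R lam δ (m + 1) x).re) rfl (fun m => ?_) (fun m x => ?_)
  · cases m with
    | zero => exact ⟨1, fun x => (abs_spin (x 0)).le⟩
    | succ m =>
      refine ⟨‖-(2 * (Real.pi : ℂ) * Complex.I)⁻¹‖ *
        (2 * Real.pi * δ * ((δ ^ (m + 1))⁻¹ * M)), fun x => ?_⟩
      refine (Complex.abs_re_le_norm _).trans ?_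
      rw [norm_mul]
      exact mul_le_mul_of_nonneg_left (norm_laurentCoeff_le hδ hM' (m + 1) x) (norm_nonneg _)
  · have hrec := laurentCoeff_rec hδ hR hcont m x
    have h1 := ruelle_add_const_mul (isingPotential α) (fun _ => 0)
      (laurentCoeff R lam δ (m + 1)) (-(2 * (Real.pi : ℂ) * Complex.I)⁻¹) x
    have h2 : ruelle (isingPotential α) (fun _ => (0 : ℂ)) x = 0 := by simp [ruelle_apply]
    simp only [zero_add, h2] at h1
    rw [ruelle_re, h1, ← Complex.re_ofReal_mul, ← Complex.sub_re,
      show ∀ a b c d : ℂ, a * (b * c) - b * d = b * (a * c - d) from fun _ _ _ _ => by ring, hrec]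
    cases m with
    | zero =>
      rw [hzero, if_pos rfl, zero_add, mul_comm (ψ x), ← mul_assoc, neg_mul_neg, inv_mul_cancel₀ hpi, one_mul]
      exact Complex.ofReal_re _
    | succ m => rw [if_neg (Nat.succ_ne_zero m), mul_zero, add_zero]

end SpectralGap

end WaltersIsing

open WaltersIsing
theorem mainTheorem5 (α : ℝ) (hα : 2 < α) :
    IsWalters (isingPotential α) ∧
    (∀ γ : ℝ, 0 < γ → γ ≤ 1 → ¬ IsHolder γ (isingPotential α)) ∧
    (∃ (lam : ℝ) (h : Conf → ℝ) (ν : Measure Conf),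
      IsRuelleTriple (isingPotential α) lam h ν) ∧
    (∀ (lam : ℝ) (h : Conf → ℝ) (ν : Measure Conf),
      IsRuelleTriple (isingPotential α) lam h ν →
      (∃ C : ℝ, 0 < C ∧ ∀ n : ℕ, 1 ≤ n →
        C / (n : ℝ) ^ α ≤ correlation firstSpin firstSpin (gibbsMeasure h ν) n) ∧
      (¬ ∃ A τ : ℝ, 0 < τ ∧ τ < 1 ∧ ∀ n : ℕ, 1 ≤ n →
        |correlation firstSpin firstSpin (gibbsMeasure h ν) n| ≤ A * τ ^ n) ∧
      (∀ s : ℝ, 0 < s → s < 1 →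
        ¬ ∃ A τ : ℝ, 0 < τ ∧ τ < 1 ∧ ∀ n : ℕ, 1 ≤ n → ∀ φ : Conf → ℝ, IsWalters φ → ∀ x : Conf,
          |(lam ^ n)⁻¹ * (ruelle (isingPotential α))^[n] φ x - h x * ∫ y, φ y ∂ν| ≤
            A * τ ^ n * waltersNorm s φ)) ∧
    (∀ s : ℝ, 0 < s → s < 1 → ¬ HasSpectralGap (isingPotential α) s) := by
  refine ⟨isWalters_isingPotential hα, fun γ hγ _ => not_isHolder_isingPotential hα hγ,
    exists_isRuelleTriple_isingPotential hα, fun lam h ν hr => ?_,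
    fun s _ hs => not_hasSpectralGap_isingPotential hα hs⟩
  obtain ⟨C, hC, hcorr⟩ := correlation_firstSpin_power_law hα hr
  refine ⟨⟨C, hC, hcorr⟩, ?_, fun s _ _ => not_exponential_convergence hα hr s⟩
  rintro ⟨A, τ, hτ, hτ1, hA⟩
  exact not_forall_rpow_le_geometric hC hτ hτ1 fun n hn =>
    (hcorr n hn).trans ((le_abs_self _).trans (hA n hn))
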